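/- Let $A_\star,\widehat A\in\mathbb{R}^{n\times n}$, $B_\star,\widehat B\in\mathbb{R}^{n\times d}$, and let $Q\in\mathbb{R}^{n\times n}$, $R\in\mathbb{R}^{d\times d}$ be symmetric positive definite, normalized so that $\underline\sigma(R)\ge 1$. Here $\|\cdot\|$ is the spectral norm and $\underline\sigma(M)=\sqrt{\lambda_{\min}(MM^\top)}$. Let $\ell\ge 1$ be an integer and $\nu>0$, and suppose that $(A_\star,B_\star)$ is $(\ell,\nu)$-controllable, i.e. $\underline\sigma\big([\,B_\star\;\;A_\star B_\star\;\cdots\;A_\star^{\ell-1}B_\star\,]\big)\ge\nu$. Let $\rho$ be a real number that is at least the spectral radius of $A_\star$, put $\tau(A_\star,\rho)=\sup_{k\ge 0}\|A_\star^k\|\rho^{-k}\in[0,\infty]$ (that is, the smallest $t$ with $\|A_\star^k\|\le t\rho^k$ for all $k\ge 0$), let $\varepsilon\ge 0$ satisfy $\|\widehat A-A_\star\|\le\varepsilon$ and $\|\widehat B-B_\star\|\le\varepsilon$, and put $\beta=\max\{1,\varepsilon\,\tau(A_\star,\rho)+\rho\}$ (in $[0,\infty]$, with $0\cdot\infty=0$).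 Then the discrete algebraic Riccati equation $$P=A_\star^\top PA_\star-A_\star^\top PB_\star(R+B_\star^\top PB_\star)^{-1}B_\star^\top PA_\star+Q$$ has exactly one positive semidefinite solution $P_\star$. If moreover the right-hand side of the inequality below is at most $1$, then the same equation with $(\widehat A,\widehat B)$ in place of $(A_\star,B_\star)$ has exactly one positive semidefinite solution $\widehat P$, and $$\|\widehat P-P_\star\|\le 32\,\varepsilon\,\ell^{5/2}\,\tau(A_\star,\rho)^3\,\beta^{2(\ell-1)}\Big(1+\frac1\nu\Big)(1+\|B_\star\|)^2\,\|P_\star\|\,\frac{\max\{\|Q\|,\|R\|\}}{\min\{\underline\sigma(R),\underline\sigma(Q)\}} .$$ -/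

import Mathlib

open scoped Matrix Matrix.Norms.L2Operator NNReal ENNReal

/-- `σ_min(M) = √(λ_min(M Mᵀ))`, the `m`-th (smallest) singular value of an `m × k` matrix.
(It is `0` when there are no rows.) -/
noncomputable def sigmaMin {m k : Type*} [Fintype m] [DecidableEq m] [Fintype k]
    (M : Matrix m k ℝ) : ℝ :=
  √(⨅ i, (Matrix.isHermitian_mul_conjTranspose_self M).eigenvalues i)

/-- `τ(M, ρ) = sup_{k ≥ 0} ‖M ^ k‖ ρ ^ (-k)`, possibly infinite: the least `t ∈ [0, ∞]` with
`‖M ^ k‖ ≤ t ρ ^ k` for all `k`. Norms of matrices are operator norms for the Euclidean norms. -/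
noncomputable def transient {n : ℕ} (M : Matrix (Fin n) (Fin n) ℝ) (ρ : ℝ≥0) : ℝ≥0∞ :=
  ⨆ k : ℕ, ‖M ^ k‖ₑ / (ρ : ℝ≥0∞) ^ k

/-- The block matrix `[B, A B, …, A ^ (ℓ - 1) B]`; column `(i, j)` is column `j` of block `i`. -/
def ctrbMatrix {n d : ℕ} (A : Matrix (Fin n) (Fin n) ℝ) (B : Matrix (Fin n) (Fin d) ℝ) (ℓ : ℕ) :
    Matrix (Fin n) (Fin ℓ × Fin d) ℝ :=
  Matrix.of fun r c => (A ^ (c.1 : ℕ) * B) r c.2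

/-- `(A, B)` is `(ℓ, ν)`-controllable. -/
def IsControllable {n d : ℕ} (A : Matrix (Fin n) (Fin n) ℝ) (B : Matrix (Fin n) (Fin d) ℝ)
    (ℓ : ℕ) (ν : ℝ≥0) : Prop :=
  1 ≤ ℓ ∧ (ν : ℝ) ≤ sigmaMin (ctrbMatrix A B ℓ)

/-- `P` is a positive semidefinite solution of the discrete algebraic Riccati equation. -/
def IsRiccatiSolution {n d : ℕ} (A : Matrix (Fin n) (Fin n) ℝ) (B : Matrix (Fin n) (Fin d) ℝ)
    (Q : Matrix (Fin n) (Fin n) ℝ) (R : Matrix (Fin d) (Fin d) ℝ)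
    (P : Matrix (Fin n) (Fin n) ℝ) : Prop :=
  P.PosSemidef ∧
    P = Aᵀ * P * A - Aᵀ * P * B * (R + Bᵀ * P * B)⁻¹ * (Bᵀ * P * A) + Q

open Classical in
/-- The positive semidefinite solution of the discrete algebraic Riccati equation
(meaningful when there is exactly one). -/
noncomputable def dare {n d : ℕ} (A : Matrix (Fin n) (Fin n) ℝ) (B : Matrix (Fin n) (Fin d) ℝ)
    (Q : Matrix (Fin n) (Fin n) ℝ) (R : Matrix (Fin d) (Fin d) ℝ) : Matrix (Fin n) (Fin n) ℝ :=
  if h : ∃ P, IsRiccatiSolution A B Q R P then h.choose else 0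

/-- `β = max {1, ε τ(A, ρ) + ρ}`. -/
noncomputable def growthFactor {n : ℕ} (A : Matrix (Fin n) (Fin n) ℝ) (ρ ε : ℝ≥0) : ℝ≥0∞ :=
  max 1 (ε * transient A ρ + ρ)

/-- The perturbation bound
`32 ε ℓ^(5/2) τ(A,ρ)³ β^(2(ℓ-1)) (1 + 1/ν) (1 + ‖B‖)² ‖P‖ max{‖Q‖,‖R‖} / min{σ_min(R),σ_min(Q)}`,
as an element of `[0, ∞]`. -/
noncomputable def dareBound {n d : ℕ} (A : Matrix (Fin n) (Fin n) ℝ)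
    (B : Matrix (Fin n) (Fin d) ℝ) (Q : Matrix (Fin n) (Fin n) ℝ) (R : Matrix (Fin d) (Fin d) ℝ)
    (P : Matrix (Fin n) (Fin n) ℝ) (ℓ : ℕ) (ν ρ ε : ℝ≥0) : ℝ≥0∞ :=
  32 * ε * (ℓ : ℝ≥0∞) ^ (5 / 2 : ℝ) * transient A ρ ^ 3 * growthFactor A ρ ε ^ (2 * (ℓ - 1))
    * (1 + 1 / (ν : ℝ≥0∞)) * (1 + ‖B‖ₑ) ^ 2 * ‖P‖ₑ
    * (max ‖Q‖ₑ ‖R‖ₑ / ENNReal.ofReal (min (sigmaMin R) (sigmaMin Q)))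

/-! The form `xᵀ P x` of a Riccati solution is the optimal cost of the linear-quadratic regulator
started at `x`, so two solutions are compared by comparing controls. Completing the square
(`stageCost_add_quadForm`) gives the dynamic programming inequality, with equality for the greedy
feedback. From it follows the comparison principle `IsRiccatiSolution.quadForm_le_mul`, which yields
uniqueness at once. Existence comes from value iteration, bounded because controllability steers
every state to the origin.

For the perturbation, take a block of `ℓ` steps of one system. Run through the other system, it
misses by a disturbance of size `ε`; controllability supplies a correction of the inputs that
cancels the accumulated error at time `ℓ` (`exists_shadowing`). The corrected block has the same
endpoints, and its deviation has energy at most `c = O(ε²)` times that of the block. Splitting the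
cost with a weight `θ` of order `ε` bounds it by `1 + θ + (1 + 1/θ) O(ε²) = 1 + O(ε)` times the
original cost. The comparison principle passes this to `P' ≤ (1 + O(ε)) P`; exchanging the systems
gives the converse, and the two together bound `‖P' - P‖`.

The perturbed pair is still controllable, with constant `ν / 2`, because the assumed smallness of
the bound keeps its controllability matrix close to the original one. -/

/-! ### Euclidean norms of coordinate vectors -/

/-- The Euclidean norm of a coordinate vector. -/
noncomputable def vnorm {m : Type*} [Fintype m] (x : m → ℝ) : ℝ := ‖WithLp.toLp 2 x‖

section vnorm

variable {m k : Type*} [Fintype m] [Fintype k]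

lemma vnorm_nonneg (x : m → ℝ) : 0 ≤ vnorm x := norm_nonneg _

lemma vnorm_zero : vnorm (0 : m → ℝ) = 0 := by simp [vnorm]

lemma vnorm_neg (x : m → ℝ) : vnorm (-x) = vnorm x := by simp [vnorm]

lemma vnorm_add_le (x y : m → ℝ) : vnorm (x + y) ≤ vnorm x + vnorm y := by
  simpa [vnorm] using norm_add_le (WithLp.toLp 2 x) (WithLp.toLp 2 y)

lemma vnorm_sub_le (x y : m → ℝ) : vnorm (x - y) ≤ vnorm x + vnorm y := by
  simpa [vnorm] using norm_sub_le (WithLp.toLp 2 x) (WithLp.toLp 2 y)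

lemma vnorm_sum_le {ι : Type*} (s : Finset ι) (f : ι → m → ℝ) :
    vnorm (∑ i ∈ s, f i) ≤ ∑ i ∈ s, vnorm (f i) := by
  classical
  induction s using Finset.induction_on with
  | empty => simp [vnorm_zero]
  | insert a s ha ih =>
    rw [Finset.sum_insert ha, Finset.sum_insert ha]
    exact (vnorm_add_le _ _).trans (by gcongr)

lemma vnorm_sq (x : m → ℝ) : vnorm x ^ 2 = x ⬝ᵥ x := by
  rw [vnorm, EuclideanSpace.norm_sq_eq]
  simp [dotProduct, sq]

lemma vnorm_eq_zero {x : m → ℝ} : vnorm x = 0 ↔ x = 0 := by simp [vnorm]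

lemma dotProduct_le_vnorm (x y : m → ℝ) : x ⬝ᵥ y ≤ vnorm x * vnorm y := by
  have := real_inner_le_norm (WithLp.toLp 2 y) (WithLp.toLp 2 x)
  rw [EuclideanSpace.inner_eq_star_dotProduct] at this
  simpa [vnorm, mul_comm] using this

lemma vnorm_mulVec_le [DecidableEq k] (A : Matrix m k ℝ) (x : k → ℝ) :
    vnorm (A *ᵥ x) ≤ ‖A‖ * vnorm x :=
  Matrix.l2_opNorm_mulVec A (WithLp.toLp 2 x)

lemma norm_transpose_real [DecidableEq m] [DecidableEq k] (A : Matrix m k ℝ) : ‖Aᵀ‖ = ‖A‖ := by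
  rw [← Matrix.l2_opNorm_conjTranspose A, Matrix.conjTranspose_eq_transpose_of_trivial]

end vnorm

/-! ### Quadratic forms -/

section quadForm

variable {m : Type*} [Fintype m]

/-- The quadratic form `x ↦ xᵀ P x`. -/
def quadForm (P : Matrix m m ℝ) (x : m → ℝ) : ℝ := x ⬝ᵥ P *ᵥ x

lemma quadForm_zero (P : Matrix m m ℝ) : quadForm P 0 = 0 := by simp [quadForm]

lemma Matrix.PosSemidef.quadForm_nonneg {P : Matrix m m ℝ} (hP : P.PosSemidef) (x : m → ℝ) :
    0 ≤ quadForm P x := by simpa [quadForm] using hP.dotProduct_mulVec_nonneg x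

omit [Fintype m] in
lemma Matrix.IsHermitian.transpose_eq {P : Matrix m m ℝ} (hP : P.IsHermitian) : Pᵀ = P := by
  rw [← Matrix.conjTranspose_eq_transpose_of_trivial]; exact hP

lemma Matrix.IsHermitian.dotProduct_mulVec_comm {P : Matrix m m ℝ} (hP : P.IsHermitian)
    (x y : m → ℝ) : x ⬝ᵥ P *ᵥ y = y ⬝ᵥ P *ᵥ x := by
  rw [Matrix.dotProduct_mulVec, ← Matrix.mulVec_transpose, hP.transpose_eq, dotProduct_comm]

lemma quadForm_add {P : Matrix m m ℝ} (hP : P.IsHermitian) (x y : m → ℝ) :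
    quadForm P (x + y) = quadForm P x + 2 * (x ⬝ᵥ P *ᵥ y) + quadForm P y := by
  simp only [quadForm, Matrix.mulVec_add, add_dotProduct, dotProduct_add,
    hP.dotProduct_mulVec_comm y x]
  ring

lemma quadForm_smul (P : Matrix m m ℝ) (c : ℝ) (x : m → ℝ) :
    quadForm P (c • x) = c ^ 2 * quadForm P x := by
  simp only [quadForm, Matrix.mulVec_smul, smul_dotProduct, dotProduct_smul, smul_eq_mul]
  ring

lemma quadForm_sub_matrix (P P' : Matrix m m ℝ) (x : m → ℝ) :
    quadForm (P - P') x = quadForm P x - quadForm P' x := by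
  simp [quadForm, Matrix.sub_mulVec, dotProduct_sub]

lemma quadForm_add_matrix (P P' : Matrix m m ℝ) (x : m → ℝ) :
    quadForm (P + P') x = quadForm P x + quadForm P' x := by
  simp [quadForm, Matrix.add_mulVec, dotProduct_add]

lemma quadForm_le_norm [DecidableEq m] (P : Matrix m m ℝ) (x : m → ℝ) :
    quadForm P x ≤ ‖P‖ * vnorm x ^ 2 := by
  calc quadForm P x ≤ vnorm x * vnorm (P *ᵥ x) := dotProduct_le_vnorm _ _
    _ ≤ vnorm x * (‖P‖ * vnorm x) := by
      gcongr
      · exact vnorm_nonneg _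
      · exact vnorm_mulVec_le _ _
    _ = ‖P‖ * vnorm x ^ 2 := by ring

/-- The weighted triangle inequality `q(x + y) ≤ (1 + θ) q(x) + (1 + θ⁻¹) q(y)`. -/
lemma quadForm_add_le {P : Matrix m m ℝ} (hP : P.PosSemidef) {θ : ℝ} (hθ : 0 < θ) (x y : m → ℝ) :
    quadForm P (x + y) ≤ (1 + θ) * quadForm P x + (1 + 1 / θ) * quadForm P y := by
  -- Expanding `q(θ x - y) ≥ 0` and dividing by `θ` bounds the cross term.
  have h := hP.quadForm_nonneg (θ • x + (-1 : ℝ) • y)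
  rw [quadForm_add hP.1, quadForm_smul, quadForm_smul, Matrix.mulVec_smul, dotProduct_smul,
    smul_dotProduct] at h
  rw [quadForm_add hP.1]
  have h2 : 2 * (x ⬝ᵥ P *ᵥ y) ≤ θ * quadForm P x + 1 / θ * quadForm P y := by
    rw [← sub_nonneg]
    have : θ * quadForm P x + 1 / θ * quadForm P y - 2 * (x ⬝ᵥ P *ᵥ y)
        = (θ ^ 2 * quadForm P x + 2 * ((-1 : ℝ) • (θ • (x ⬝ᵥ P *ᵥ y))) +
          (-1) ^ 2 * quadForm P y) / θ := by
      simp only [smul_eq_mul]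
      field_simp
      ring
    rw [this]
    exact div_nonneg h hθ.le
  linarith

/-- Polarization. It also turns pointwise convergence of quadratic forms into convergence of
matrices. -/
lemma apply_eq_quadForm [DecidableEq m] {P : Matrix m m ℝ} (hP : P.IsHermitian) (i j : m) :
    P i j = (quadForm P (Pi.single i 1 + Pi.single j 1) - quadForm P (Pi.single i 1) -
      quadForm P (Pi.single j 1)) / 2 := by
  rw [quadForm_add hP]
  simp
  ring

lemma ext_of_quadForm [DecidableEq m] {P P' : Matrix m m ℝ} (hP : P.IsHermitian)
    (hP' : P'.IsHermitian) (h : ∀ x, quadForm P x = quadForm P' x) : P = P' := by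
  ext i j
  rw [apply_eq_quadForm hP, apply_eq_quadForm hP', h, h, h]

/-- The norm of a symmetric operator is the supremum of its absolute Rayleigh quotients. -/
lemma norm_le_of_abs_quadForm_le [DecidableEq m] {D : Matrix m m ℝ} (hD : D.IsHermitian) {c : ℝ}
    (hc : 0 ≤ c) (h : ∀ x, |quadForm D x| ≤ c * vnorm x ^ 2) : ‖D‖ ≤ c := by
  rw [← Matrix.l2_opNorm_toEuclideanCLM,
    ContinuousLinearMap.norm_eq_iSup_rayleighQuotient (T := Matrix.toEuclideanCLM (𝕜 := ℝ) D)
      (Matrix.isSymmetric_toEuclideanLin_iff.mpr hD)]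
  refine ciSup_le fun x => ?_
  rw [ContinuousLinearMap.rayleighQuotient, abs_div, abs_sq]
  refine div_le_of_le_mul₀ (by positivity) hc ?_
  have := h x.ofLp
  rw [ContinuousLinearMap.reApplyInnerSelf_apply, real_inner_comm, Matrix.inner_toEuclideanCLM]
  simpa [quadForm, vnorm] using this

end quadForm

/-! ### Smallest singular values -/

section sigmaMin

variable {m k : Type*} [Fintype m] [DecidableEq m] [Fintype k]

lemma Matrix.IsHermitian.le_quadForm {H : Matrix m m ℝ} (hH : H.IsHermitian) {c : ℝ}
    (hc : ∀ i, c ≤ hH.eigenvalues i) (x : m → ℝ) : c * vnorm x ^ 2 ≤ quadForm H x := by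
  have h1 : (H - c • (1 : Matrix m m ℝ)).PosSemidef := by
    have h2 : H - c • (1 : Matrix m m ℝ) = (hH.eigenvectorUnitary : Matrix m m ℝ) *
        Matrix.diagonal (fun i => hH.eigenvalues i - c) *
          (hH.eigenvectorUnitary : Matrix m m ℝ)ᴴ := by
      have h3 : Matrix.diagonal (fun i => hH.eigenvalues i - c) =
          Matrix.diagonal hH.eigenvalues - c • (1 : Matrix m m ℝ) := by
        ext i j
        by_cases hij : i = j <;> simp [Matrix.diagonal, hij]
      have h4 : (hH.eigenvectorUnitary : Matrix m m ℝ) * (hH.eigenvectorUnitary : Matrix m m ℝ)ᴴ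
          = 1 := Unitary.coe_mul_star_self _
      rw [h3, Matrix.mul_sub, Matrix.sub_mul, Matrix.mul_smul, Matrix.mul_one, Matrix.smul_mul, h4]
      congr 1
      simpa [Unitary.conjStarAlgAut_apply, Matrix.star_eq_conjTranspose] using hH.spectral_theorem
    rw [h2]
    exact (Matrix.PosSemidef.diagonal fun i => sub_nonneg.2 (hc i)).mul_mul_conjTranspose_same _
  have h5 := h1.quadForm_nonneg x
  rw [quadForm_sub_matrix] at h5
  have h6 : quadForm (c • (1 : Matrix m m ℝ)) x = c * vnorm x ^ 2 := by
    rw [vnorm_sq]; simp [quadForm, Matrix.smul_mulVec]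
  linarith

lemma sigmaMin_sq_mul_le [DecidableEq k] (M : Matrix m k ℝ) (x : m → ℝ) :
    sigmaMin M ^ 2 * vnorm x ^ 2 ≤ vnorm (Mᵀ *ᵥ x) ^ 2 := by
  rw [sigmaMin, Real.sq_sqrt (Real.iInf_nonneg
    fun i => Matrix.eigenvalues_self_mul_conjTranspose_nonneg M i)]
  refine ((Matrix.isHermitian_mul_conjTranspose_self M).le_quadForm
    (fun i => ciInf_le (Set.finite_range _).bddBelow i) x).trans_eq ?_
  rw [vnorm_sq, quadForm, ← Matrix.mulVec_mulVec, Matrix.dotProduct_mulVec,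
    ← Matrix.mulVec_transpose, Matrix.conjTranspose_eq_transpose_of_trivial]

/-- Testing `sigmaMin_sq_mul_le` on a unit eigenvector gives `σ² ≤ λ²`, and `λ ≥ 0`, so every
eigenvalue of `Q` is at least `σ`. -/
lemma sigmaMin_mul_le_quadForm {Q : Matrix m m ℝ} (hQ : Q.PosSemidef) (x : m → ℝ) :
    sigmaMin Q * vnorm x ^ 2 ≤ quadForm Q x := by
  refine hQ.1.le_quadForm (fun i => ?_) x
  set v : m → ℝ := ⇑(hQ.1.eigenvectorBasis i) with hv
  have h1 : vnorm v = 1 := hQ.1.eigenvectorBasis.norm_eq_one i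
  have h2 := sigmaMin_sq_mul_le Q v
  rw [hQ.1.transpose_eq, hQ.1.mulVec_eigenvectorBasis i, ← hv, vnorm_sq (_ • _), smul_dotProduct,
    dotProduct_smul, ← vnorm_sq, h1] at h2
  refine le_of_sq_le_sq ?_ (hQ.eigenvalues_nonneg i)
  simpa [sq] using h2

lemma sigmaMin_pos [Nonempty m] {Q : Matrix m m ℝ} (hQ : Q.PosDef) : 0 < sigmaMin Q := by
  refine Real.sqrt_pos.2 ?_
  obtain ⟨i, hi⟩ := Finite.exists_min
    (Matrix.isHermitian_mul_conjTranspose_self Q).eigenvalues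
  have : (Q * Qᴴ).PosDef := by
    refine Matrix.PosDef.mul_conjTranspose_self Q ?_
    exact Matrix.vecMul_injective_of_isUnit hQ.isUnit
  exact (this.eigenvalues_pos i).trans_le (le_ciInf hi)

lemma sigmaMin_le_norm [Nonempty m] {Q : Matrix m m ℝ} (hQ : Q.PosSemidef) :
    sigmaMin Q ≤ ‖Q‖ := by
  obtain ⟨i⟩ := ‹Nonempty m›
  have h1 : vnorm (Pi.single i (1 : ℝ)) = 1 := by simp [vnorm]
  simpa [h1] using (sigmaMin_mul_le_quadForm hQ (Pi.single i 1)).trans (quadForm_le_norm _ _)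

end sigmaMin

/-! ### The Riccati operator and the linear-quadratic regulator -/

section riccati

variable {n d : ℕ} {A : Matrix (Fin n) (Fin n) ℝ} {B : Matrix (Fin n) (Fin d) ℝ}
  {Q : Matrix (Fin n) (Fin n) ℝ} {R : Matrix (Fin d) (Fin d) ℝ} {P : Matrix (Fin n) (Fin n) ℝ}

/-- The Riccati operator. -/
noncomputable def riccati (A : Matrix (Fin n) (Fin n) ℝ) (B : Matrix (Fin n) (Fin d) ℝ)
    (Q : Matrix (Fin n) (Fin n) ℝ) (R : Matrix (Fin d) (Fin d) ℝ) (P : Matrix (Fin n) (Fin n) ℝ) :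
    Matrix (Fin n) (Fin n) ℝ :=
  Aᵀ * P * A - Aᵀ * P * B * (R + Bᵀ * P * B)⁻¹ * (Bᵀ * P * A) + Q

/-- The feedback gain that is greedy with respect to the terminal cost `P`. -/
noncomputable def gain (A : Matrix (Fin n) (Fin n) ℝ) (B : Matrix (Fin n) (Fin d) ℝ)
    (R : Matrix (Fin d) (Fin d) ℝ) (P : Matrix (Fin n) (Fin n) ℝ) : Matrix (Fin d) (Fin n) ℝ :=
  (R + Bᵀ * P * B)⁻¹ * (Bᵀ * P * A)

/-- The cost of one time step. -/
def stageCost (Q : Matrix (Fin n) (Fin n) ℝ) (R : Matrix (Fin d) (Fin d) ℝ) (x : Fin n → ℝ)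
    (u : Fin d → ℝ) : ℝ := quadForm Q x + quadForm R u

/-- `x` is the state sequence of the system `(A, B)` under the inputs `u`. -/
def IsTrajectory (A : Matrix (Fin n) (Fin n) ℝ) (B : Matrix (Fin n) (Fin d) ℝ)
    (x : ℕ → Fin n → ℝ) (u : ℕ → Fin d → ℝ) : Prop :=
  ∀ t, x (t + 1) = A *ᵥ x t + B *ᵥ u t

lemma stageCost_nonneg (hQ : Q.PosSemidef) (hR : R.PosSemidef) (x : Fin n → ℝ) (u : Fin d → ℝ) :
    0 ≤ stageCost Q R x u := add_nonneg (hQ.quadForm_nonneg x) (hR.quadForm_nonneg u)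

lemma posDef_add_conj (hR : R.PosDef) (hP : P.PosSemidef) : (R + Bᵀ * P * B).PosDef := by
  have := hP.conjTranspose_mul_mul_same B
  rw [Matrix.conjTranspose_eq_transpose_of_trivial] at this
  exact hR.add_posSemidef this

lemma dotProduct_transpose_mulVec {m k : Type*} [Fintype m] [Fintype k] (M : Matrix m k ℝ)
    (x : k → ℝ) (y : m → ℝ) : x ⬝ᵥ Mᵀ *ᵥ y = (M *ᵥ x) ⬝ᵥ y := by
  rw [Matrix.dotProduct_mulVec, Matrix.vecMul_transpose]

/-- Completing the square in `u`. The last term is nonnegative and vanishes exactly at the greedy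
input `-K x`, where `K` is the gain. -/
lemma stageCost_add_quadForm (hR : R.PosDef) (hP : P.PosSemidef) (x : Fin n → ℝ)
    (u : Fin d → ℝ) :
    stageCost Q R x u + quadForm P (A *ᵥ x + B *ᵥ u) =
      quadForm (riccati A B Q R P) x +
        quadForm (R + Bᵀ * P * B) (u + gain A B R P *ᵥ x) := by
  have hS := posDef_add_conj (B := B) hR hP
  have hG : (R + Bᵀ * P * B) *ᵥ (gain A B R P *ᵥ x) = Bᵀ *ᵥ (P *ᵥ (A *ᵥ x)) := by
    rw [gain, Matrix.mulVec_mulVec, Matrix.mul_nonsing_inv_cancel_left _ _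
      ((Matrix.isUnit_iff_isUnit_det _).1 hS.isUnit)]
    simp [Matrix.mulVec_mulVec, Matrix.mul_assoc]
  have hric : quadForm (riccati A B Q R P) x = quadForm P (A *ᵥ x) -
      (B *ᵥ (gain A B R P *ᵥ x)) ⬝ᵥ (P *ᵥ (A *ᵥ x)) + quadForm Q x := by
    rw [riccati, quadForm_add_matrix, quadForm_sub_matrix]
    congr 2
    · simp only [quadForm, ← Matrix.mulVec_mulVec, dotProduct_transpose_mulVec]
    · rw [hP.1.dotProduct_mulVec_comm]
      simp only [quadForm, gain, ← Matrix.mulVec_mulVec, dotProduct_transpose_mulVec]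
  have hBu : quadForm P (B *ᵥ u) = u ⬝ᵥ (Bᵀ * P * B) *ᵥ u := by
    simp only [quadForm, ← Matrix.mulVec_mulVec, dotProduct_transpose_mulVec]
  have hSK : quadForm (R + Bᵀ * P * B) (gain A B R P *ᵥ x) =
      (gain A B R P *ᵥ x) ⬝ᵥ Bᵀ *ᵥ (P *ᵥ (A *ᵥ x)) := by rw [quadForm, hG]
  rw [quadForm_add hP.1, quadForm_add hS.1, hG, hric, hBu, stageCost,
    hP.1.dotProduct_mulVec_comm (A *ᵥ x) (B *ᵥ u), quadForm_add_matrix R,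
    hSK, dotProduct_transpose_mulVec, dotProduct_transpose_mulVec]
  simp only [quadForm]
  ring

/-- One step of dynamic programming: no input does better than the Riccati operator. -/
lemma quadForm_riccati_le (hR : R.PosDef) (hP : P.PosSemidef) (x : Fin n → ℝ) (u : Fin d → ℝ) :
    quadForm (riccati A B Q R P) x ≤ stageCost Q R x u + quadForm P (A *ᵥ x + B *ᵥ u) := by
  rw [stageCost_add_quadForm hR hP]
  have := (posDef_add_conj (B := B) hR hP).posSemidef.quadForm_nonneg (u + gain A B R P *ᵥ x)
  linarith

lemma quadForm_riccati_eq (hR : R.PosDef) (hP : P.PosSemidef) (x : Fin n → ℝ) :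
    quadForm (riccati A B Q R P) x = stageCost Q R x (-(gain A B R P *ᵥ x)) +
      quadForm P (A *ᵥ x + B *ᵥ -(gain A B R P *ᵥ x)) := by
  rw [stageCost_add_quadForm hR hP, neg_add_cancel, quadForm_zero, add_zero]

lemma riccati_posSemidef (hQ : Q.PosSemidef) (hR : R.PosDef) (hP : P.PosSemidef) :
    (riccati A B Q R P).PosSemidef := by
  refine Matrix.PosSemidef.of_dotProduct_mulVec_nonneg ?_ fun x => ?_
  · have h1 := (hP.conjTranspose_mul_mul_same A).1
    have h2 := ((posDef_add_conj (B := B) hR hP).inv.posSemidef.conjTranspose_mul_mul_same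
      (Bᵀ * P * A)).1
    rw [Matrix.conjTranspose_eq_transpose_of_trivial] at h1 h2
    rw [Matrix.transpose_mul, Matrix.transpose_mul, Matrix.transpose_transpose, hP.1.transpose_eq,
      ← Matrix.mul_assoc Aᵀ] at h2
    exact (h1.sub h2).add hQ.1
  · have := quadForm_riccati_eq (A := A) (B := B) (Q := Q) hR hP x
    rw [quadForm] at this
    rw [star_trivial, this]
    exact add_nonneg (stageCost_nonneg hQ hR.posSemidef _ _) (hP.quadForm_nonneg _)

/-- The input that is greedy for `P'` is a competitor for `P`. -/
lemma riccati_mono {P' : Matrix (Fin n) (Fin n) ℝ} (hR : R.PosDef)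
    (hP : P.PosSemidef) (hP' : P'.PosSemidef) (h : ∀ x, quadForm P x ≤ quadForm P' x)
    (x : Fin n → ℝ) : quadForm (riccati A B Q R P) x ≤ quadForm (riccati A B Q R P') x := by
  rw [quadForm_riccati_eq hR hP' x]
  exact (quadForm_riccati_le hR hP x _).trans (by gcongr; exact h _)

/-! ### Optimality, uniqueness and existence of Riccati solutions -/

lemma IsRiccatiSolution.quadForm_le (h : IsRiccatiSolution A B Q R P) (hR : R.PosDef)
    {x : ℕ → Fin n → ℝ} {u : ℕ → Fin d → ℝ} (hx : IsTrajectory A B x u) (N : ℕ) :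
    quadForm P (x 0) ≤ ∑ t ∈ Finset.range N, stageCost Q R (x t) (u t) + quadForm P (x N) := by
  induction N with
  | zero => simp
  | succ N ih =>
    have h1 := quadForm_riccati_le (A := A) (B := B) (Q := Q) hR h.1 (x N) (u N)
    rw [← hx N, riccati, ← h.2] at h1
    rw [Finset.sum_range_succ]
    linarith

lemma IsRiccatiSolution.quadForm_stateCost_le (h : IsRiccatiSolution A B Q R P) (hR : R.PosDef)
    (x : Fin n → ℝ) : quadForm Q x ≤ quadForm P x := by
  have h1 := quadForm_riccati_eq (A := A) (B := B) (Q := Q) hR h.1 x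
  rw [riccati, ← h.2, stageCost] at h1
  have h2 := h.1.quadForm_nonneg (A *ᵥ x + B *ᵥ -(gain A B R P *ᵥ x))
  have h3 := hR.posSemidef.quadForm_nonneg (-(gain A B R P *ᵥ x))
  linarith

/-- If a quadratic form `P'` decreases along every trajectory of `(A, B)`, over blocks of `ℓ`
steps, by at most `c` times the cost of the block, then it is at most `c` times the optimal cost. -/
lemma IsRiccatiSolution.quadForm_le_mul (h : IsRiccatiSolution A B Q R P) (hQ : Q.PosDef)
    (hR : R.PosDef) {P' : Matrix (Fin n) (Fin n) ℝ} {ℓ : ℕ} (hℓ : 1 ≤ ℓ) {c : ℝ} (hc : 0 ≤ c)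
    (hP' : ∀ x u, IsTrajectory A B x u → quadForm P' (x 0) ≤
      c * ∑ t ∈ Finset.range ℓ, stageCost Q R (x t) (u t) + quadForm P' (x ℓ))
    (x₀ : Fin n → ℝ) : quadForm P' x₀ ≤ c * quadForm P x₀ := by
  rcases isEmpty_or_nonempty (Fin n) with hn | hn
  · simp [quadForm, Subsingleton.elim x₀ 0]
  set K := gain A B R P
  -- The closed loop of `P`: along it the dynamic programming inequality is an equality, so the
  -- costs telescope.
  set x : ℕ → Fin n → ℝ := fun t => (A - B * K) ^ t *ᵥ x₀ with hxdef
  set u : ℕ → Fin d → ℝ := fun t => -(K *ᵥ x t) with hudef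
  have hx : IsTrajectory A B x u := fun t => by
    simp only [hxdef, hudef, pow_succ', Matrix.mulVec_neg, Matrix.mulVec_mulVec]
    rw [← sub_eq_add_neg, ← Matrix.sub_mulVec, Matrix.sub_mul, Matrix.mul_assoc B]
  have hx0 : x 0 = x₀ := by simp [hxdef]
  have hstep : ∀ t, quadForm P (x t) = stageCost Q R (x t) (u t) + quadForm P (x (t + 1)) := by
    intro t
    have h1 := quadForm_riccati_eq (A := A) (B := B) (Q := Q) hR h.1 (x t)
    rw [riccati, ← h.2] at h1
    rw [hx t]
    exact h1
  have hsum : ∀ N, ∑ t ∈ Finset.range N, stageCost Q R (x t) (u t) =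
      quadForm P x₀ - quadForm P (x N) := by
    intro N
    induction N with
    | zero => simp [hx0]
    | succ N ih => rw [Finset.sum_range_succ, ih, hstep N]; ring
  -- Finite total cost replaces a stability argument: the stage costs tend to zero, and since `Q` is
  -- positive definite they dominate the leftover term `quadForm P' (x (k * ℓ))`.
  have hsummable : Summable fun t => stageCost Q R (x t) (u t) := by
    refine summable_of_sum_range_le (c := quadForm P x₀)
      (fun t => stageCost_nonneg hQ.posSemidef hR.posSemidef _ _) fun N => ?_
    rw [hsum]
    linarith [h.1.quadForm_nonneg (x N)]
  have hblock : ∀ k, quadForm P' x₀ ≤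
      c * ∑ t ∈ Finset.range (k * ℓ), stageCost Q R (x t) (u t) + quadForm P' (x (k * ℓ)) := by
    intro k
    induction k with
    | zero => simp [hx0]
    | succ k ih =>
      have h1 := hP' (fun t => x (k * ℓ + t)) (fun t => u (k * ℓ + t))
        (fun t => hx (k * ℓ + t))
      rw [Nat.succ_mul, Finset.sum_range_add, mul_add]
      rw [add_zero] at h1
      linarith
  have hq := sigmaMin_pos hQ
  have hbound : ∀ k : ℕ, quadForm P' x₀ ≤ c * quadForm P x₀ +
      ‖P'‖ / sigmaMin Q * stageCost Q R (x (k * ℓ)) (u (k * ℓ)) := by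
    intro k
    refine (hblock k).trans (add_le_add ?_ ?_)
    · refine mul_le_mul_of_nonneg_left ?_ hc
      rw [hsum]
      linarith [h.1.quadForm_nonneg (x (k * ℓ))]
    · calc quadForm P' (x (k * ℓ)) ≤ ‖P'‖ * vnorm (x (k * ℓ)) ^ 2 := quadForm_le_norm _ _
        _ = ‖P'‖ / sigmaMin Q * (sigmaMin Q * vnorm (x (k * ℓ)) ^ 2) := by field_simp
        _ ≤ _ := by
          refine mul_le_mul_of_nonneg_left ?_ (by positivity)
          have := hR.posSemidef.quadForm_nonneg (u (k * ℓ))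
          rw [stageCost]
          linarith [sigmaMin_mul_le_quadForm hQ.posSemidef (x (k * ℓ))]
  have hlim : Filter.Tendsto (fun k : ℕ => c * quadForm P x₀ +
      ‖P'‖ / sigmaMin Q * stageCost Q R (x (k * ℓ)) (u (k * ℓ))) Filter.atTop
      (nhds (c * quadForm P x₀ + ‖P'‖ / sigmaMin Q * 0)) := by
    refine tendsto_const_nhds.add (tendsto_const_nhds.mul ?_)
    exact hsummable.tendsto_atTop_zero.comp (Filter.tendsto_id.atTop_mul_const' (by lia))
  simpa using ge_of_tendsto' hlim hbound

/-- Each solution satisfies the comparison principle for the other, with blocks of length `1` and `c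
= 1`. -/
lemma IsRiccatiSolution.unique {P' : Matrix (Fin n) (Fin n) ℝ} (hQ : Q.PosDef) (hR : R.PosDef)
    (h : IsRiccatiSolution A B Q R P) (h' : IsRiccatiSolution A B Q R P') : P = P' := by
  refine ext_of_quadForm h.1.1 h'.1.1 fun x => le_antisymm ?_ ?_
  · simpa using h'.quadForm_le_mul hQ hR le_rfl zero_le_one
      (fun x u hx => by simpa using h.quadForm_le hR hx 1) x
  · simpa using h.quadForm_le_mul hQ hR le_rfl zero_le_one
      (fun x u hx => by simpa using h'.quadForm_le hR hx 1) x

/-- If every state can be steered to the origin in `ℓ` steps, the Riccati equation is solvable. -/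
lemma exists_isRiccatiSolution (hQ : Q.PosDef) (hR : R.PosDef) {ℓ : ℕ}
    (hnull : ∀ x₀, ∃ x u, IsTrajectory A B x u ∧ x 0 = x₀ ∧ x ℓ = 0) :
    ∃ P, IsRiccatiSolution A B Q R P := by
  -- Value iteration: `V k` is the optimal cost over `k` steps with no terminal cost.
  set V : ℕ → Matrix (Fin n) (Fin n) ℝ := fun k => (riccati A B Q R)^[k] 0 with hV
  have hVsucc : ∀ k, V (k + 1) = riccati A B Q R (V k) := fun k =>
    Function.iterate_succ_apply' _ _ _
  have hVpos : ∀ k, (V k).PosSemidef := by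
    intro k
    induction k with
    | zero => exact Matrix.PosSemidef.zero
    | succ k ih => rw [hVsucc]; exact riccati_posSemidef hQ.posSemidef hR ih
  have hVmono : ∀ k x, quadForm (V k) x ≤ quadForm (V (k + 1)) x := by
    intro k
    induction k with
    | zero =>
      intro x
      simpa [hV, quadForm] using (hVpos 1).quadForm_nonneg x
    | succ k ih =>
      intro x
      rw [hVsucc k, hVsucc (k + 1)]
      exact riccati_mono hR (hVpos k) (hVpos _) ih x
  -- Along a trajectory that ends at the origin, the bound with `m = ℓ` does not depend on `k`.
  have hVle : ∀ {x u}, IsTrajectory A B x u → ∀ k m, quadForm (V (k + m)) (x 0) ≤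
      ∑ t ∈ Finset.range m, stageCost Q R (x t) (u t) + quadForm (V k) (x m) := by
    intro x u hx k m
    induction m generalizing k with
    | zero => simp
    | succ m ih =>
      have h1 := ih (k + 1)
      have h2 := quadForm_riccati_le (A := A) (B := B) (Q := Q) hR (hVpos k) (x m) (u m)
      rw [← hx m, ← hVsucc] at h2
      rw [Finset.sum_range_succ, show k + (m + 1) = k + 1 + m by ring]
      linarith
  have hconv : ∀ x₀, ∃ v, Filter.Tendsto (fun k => quadForm (V k) x₀) Filter.atTop (nhds v) := by
    intro x₀
    obtain ⟨x, u, hx, rfl, hxℓ⟩ := hnull x₀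
    have hm : Monotone fun k => quadForm (V k) (x 0) := monotone_nat_of_le_succ fun k => hVmono k _
    refine ⟨_, tendsto_atTop_ciSup hm
      ⟨∑ t ∈ Finset.range ℓ, stageCost Q R (x t) (u t), ?_⟩⟩
    rintro _ ⟨k, rfl⟩
    have h1 := hVle hx k ℓ
    rw [hxℓ, quadForm_zero, add_zero] at h1
    exact (hm (Nat.le_add_right k ℓ)).trans h1
  choose v hv using hconv
  obtain ⟨P, hP⟩ : ∃ P, Filter.Tendsto V Filter.atTop (nhds P) := by
    refine ⟨Matrix.of fun i j => (v (Pi.single i 1 + Pi.single j 1) - v (Pi.single i 1) -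
      v (Pi.single j 1)) / 2, ?_⟩
    refine tendsto_pi_nhds.2 fun i => tendsto_pi_nhds.2 fun j => ?_
    simp_rw [fun k => apply_eq_quadForm (hVpos k).1 i j]
    exact (((hv _).sub (hv _)).sub (hv _)).div_const 2
  have hPpos : P.PosSemidef := by
    refine Matrix.PosSemidef.of_dotProduct_mulVec_nonneg ?_ fun x => ?_
    · have h1 : Filter.Tendsto (fun k => (V k)ᴴ) Filter.atTop (nhds Pᴴ) :=
        (continuous_id.matrix_conjTranspose.tendsto P).comp hP
      simp_rw [fun k => (hVpos k).1.eq] at h1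
      exact tendsto_nhds_unique h1 hP
    · have h1 : Filter.Tendsto (fun k => quadForm (V k) x) Filter.atTop (nhds (quadForm P x)) :=
        ((continuous_const.dotProduct (continuous_id.matrix_mulVec continuous_const)).tendsto
          P).comp hP
      exact ge_of_tendsto' h1 fun k => (hVpos k).quadForm_nonneg x
  refine ⟨P, hPpos, ?_⟩
  -- `R + Bᵀ P B` is invertible at the limit, so the Riccati operator is continuous there and the
  -- limit is a fixed point.
  have hcont : ContinuousAt (riccati A B Q R) P := by
    have hS := posDef_add_conj (B := B) hR hPpos
    have h1 : ContinuousAt (fun X : Matrix (Fin n) (Fin n) ℝ => (R + Bᵀ * X * B)⁻¹) P := by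
      have h2 : ContinuousAt (fun Y : Matrix (Fin d) (Fin d) ℝ => Y⁻¹) (R + Bᵀ * P * B) := by
        have h3 := NormedRing.inverse_continuousAt hS.isUnit.unit
        simpa [Matrix.nonsing_inv_eq_ringInverse] using! h3
      exact h2.comp (f := fun X : Matrix (Fin n) (Fin n) ℝ => R + Bᵀ * X * B) (by fun_prop)
    unfold riccati
    fun_prop
  have h2 : Filter.Tendsto (fun k => V (k + 1)) Filter.atTop (nhds (riccati A B Q R P)) := by
    simp_rw [hVsucc]
    exact hcont.tendsto.comp hP
  exact tendsto_nhds_unique (hP.comp (Filter.tendsto_add_atTop_nat 1)) h2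

end riccati

/-! ### Perturbed powers -/

section powers

variable {n d : ℕ} {A A' : Matrix (Fin n) (Fin n) ℝ}

/-- Discrete variation of constants: the powers of `A'` solve the recursion of `A` with forcing `(A'
- A) A' ^ i`. -/
lemma pow_eq_add_sum (A A' : Matrix (Fin n) (Fin n) ℝ) (k : ℕ) :
    A' ^ k = A ^ k + ∑ i ∈ Finset.range k, A ^ (k - 1 - i) * (A' - A) * A' ^ i := by
  induction k with
  | zero => simp
  | succ k ih =>
    have h1 : ∑ i ∈ Finset.range k, A ^ (k + 1 - 1 - i) * (A' - A) * A' ^ i =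
        A * ∑ i ∈ Finset.range k, A ^ (k - 1 - i) * (A' - A) * A' ^ i := by
      rw [Finset.mul_sum]
      refine Finset.sum_congr rfl fun i hi => ?_
      have : k + 1 - 1 - i = (k - 1 - i) + 1 := by have := Finset.mem_range.1 hi; lia
      rw [this, pow_succ']
      simp only [mul_assoc]
    rw [Finset.sum_range_succ, h1, eq_sub_of_add_eq' ih.symm, pow_succ' A', pow_succ' A]
    simp
    noncomm_ring

variable {T ρ ε : ℝ}

/-- The bounds `a i` are left free so that the strong induction in `norm_pow_le_of_perturb` can
insert its own hypothesis. -/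
lemma norm_pow_sub_pow_le (hT : ∀ k, ‖A ^ k‖ ≤ T * ρ ^ k)
    (hA : ‖A' - A‖ ≤ ε) {a : ℕ → ℝ} {k : ℕ} (ha : ∀ i < k, ‖A' ^ i‖ ≤ a i) :
    ‖A' ^ k - A ^ k‖ ≤ ∑ i ∈ Finset.range k, T * ρ ^ (k - 1 - i) * ε * a i := by
  rw [pow_eq_add_sum A A' k, add_sub_cancel_left]
  refine norm_sum_le_of_le _ fun i hi => ?_
  have h1 := hT (k - 1 - i)
  have h2 := (norm_nonneg _).trans h1
  have h3 := (norm_nonneg _).trans hA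
  refine (norm_mul_le _ _).trans (mul_le_mul ((norm_mul_le _ _).trans ?_)
    (ha i (Finset.mem_range.1 hi)) (norm_nonneg _) (mul_nonneg h2 h3))
  exact mul_le_mul h1 hA (norm_nonneg _) h2

/-- The rate `ε T + ρ` makes the induction close exactly: as `ε T = (ε T + ρ) - ρ`, the sum is
geometric and collapses to `T ((ε T + ρ) ^ k - ρ ^ k)`. -/
lemma norm_pow_le_of_perturb (hT : ∀ k, ‖A ^ k‖ ≤ T * ρ ^ k) (hA : ‖A' - A‖ ≤ ε) (k : ℕ) :
    ‖A' ^ k‖ ≤ T * (ε * T + ρ) ^ k := by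
  induction k using Nat.strong_induction_on with
  | _ k ih =>
    have h1 := norm_pow_sub_pow_le hT hA ih
    have h2 : ‖A' ^ k‖ ≤ ‖A ^ k‖ + ‖A' ^ k - A ^ k‖ := by
      simpa using norm_add_le (A ^ k) (A' ^ k - A ^ k)
    refine (h2.trans (add_le_add (hT k) h1)).trans_eq ?_
    have h3 := geom_sum₂_mul (ε * T + ρ) ρ k
    have h4 : ∑ i ∈ Finset.range k, T * ρ ^ (k - 1 - i) * ε * (T * (ε * T + ρ) ^ i) =
        T * ((∑ i ∈ Finset.range k, (ε * T + ρ) ^ i * ρ ^ (k - 1 - i)) * (ε * T + ρ - ρ)) := by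
      rw [Finset.sum_mul, Finset.mul_sum]
      exact Finset.sum_congr rfl fun i _ => by ring
    rw [h4, h3]
    ring

lemma norm_pow_sub_pow_le_of_perturb (hT : ∀ k, ‖A ^ k‖ ≤ T * ρ ^ k) (hA : ‖A' - A‖ ≤ ε)
    (hT0 : 0 ≤ T) (hρ : 0 ≤ ρ) {β : ℝ} (hβ1 : 1 ≤ β) (hβ : ε * T + ρ ≤ β) {k ℓ : ℕ}
    (hk : k < ℓ) : ‖A' ^ k - A ^ k‖ ≤ ℓ * T * ε * (T * β ^ (ℓ - 1)) := by
  have hε : 0 ≤ ε := (norm_nonneg _).trans hA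
  have hεT : 0 ≤ ε * T := mul_nonneg hε hT0
  have hβ0 : (0 : ℝ) ≤ β := zero_le_one.trans hβ1
  refine (norm_pow_sub_pow_le hT hA fun i _ => norm_pow_le_of_perturb hT hA i).trans ?_
  have h1 : ∀ i ∈ Finset.range k, T * ρ ^ (k - 1 - i) * ε * (T * (ε * T + ρ) ^ i) ≤
      T * ε * (T * β ^ (ℓ - 1)) := by
    intro i hi
    have hi' := Finset.mem_range.1 hi
    have h2 : ρ ^ (k - 1 - i) * (ε * T + ρ) ^ i ≤ β ^ (ℓ - 1) := by
      calc ρ ^ (k - 1 - i) * (ε * T + ρ) ^ i ≤ β ^ (k - 1 - i) * β ^ i := by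
            gcongr
            linarith
        _ = β ^ (k - 1 - i + i) := (pow_add _ _ _).symm
        _ ≤ β ^ (ℓ - 1) := pow_le_pow_right₀ hβ1 (by lia)
    calc _ = T * ε * (T * (ρ ^ (k - 1 - i) * (ε * T + ρ) ^ i)) := by ring
      _ ≤ _ := by gcongr
  refine (Finset.sum_le_sum h1).trans ?_
  rw [Finset.sum_const, Finset.card_range, nsmul_eq_mul, mul_assoc (ℓ : ℝ), mul_assoc (ℓ : ℝ)]
  gcongr

end powers

/-! ### Steering -/

section steering

variable {n d : ℕ} {A A' : Matrix (Fin n) (Fin n) ℝ} {B B' : Matrix (Fin n) (Fin d) ℝ}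

/-- Every vector is reached from the origin in `ℓ` steps, by inputs of norm at most `g` times its
norm. -/
def Steers (A : Matrix (Fin n) (Fin n) ℝ) (B : Matrix (Fin n) (Fin d) ℝ) (ℓ : ℕ) (g : ℝ) : Prop :=
  ∀ w, ∃ δ : ℕ → Fin d → ℝ, ∑ i ∈ Finset.range ℓ, A ^ (ℓ - 1 - i) *ᵥ (B *ᵥ δ i) = w ∧
    ∑ i ∈ Finset.range ℓ, vnorm (δ i) ^ 2 ≤ g ^ 2 * vnorm w ^ 2

lemma ctrbMatrix_mulVec (ℓ : ℕ) (v : Fin ℓ × Fin d → ℝ) :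
    ctrbMatrix A B ℓ *ᵥ v = ∑ i : Fin ℓ, A ^ (i : ℕ) *ᵥ (B *ᵥ fun j => v (i, j)) := by
  ext r
  simp only [Matrix.mulVec_mulVec, Finset.sum_apply]
  simp only [Matrix.mulVec, dotProduct, ctrbMatrix, Matrix.of_apply, Fintype.sum_prod_type]

lemma vnorm_sq_prod {ι κ : Type*} [Fintype ι] [Fintype κ] (v : ι × κ → ℝ) :
    vnorm v ^ 2 = ∑ i, vnorm (fun j => v (i, j)) ^ 2 := by
  simp only [vnorm_sq, dotProduct, Fintype.sum_prod_type]

/-- The input is the least-norm solution `D = Cᵀ (C Cᵀ)⁻¹ w` of `C D = w`. With `z = (C Cᵀ)⁻¹ w`,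
one has `‖D‖² = z ⬝ w ≤ ‖z‖ ‖w‖` and `c ‖z‖ ≤ ‖D‖`, hence `c ‖D‖ ≤ ‖w‖`. -/
lemma steers_of_le_vnorm {ℓ : ℕ} {c : ℝ} (hc : 0 < c)
    (h : ∀ y, c ^ 2 * vnorm y ^ 2 ≤ vnorm ((ctrbMatrix A B ℓ)ᵀ *ᵥ y) ^ 2) :
    Steers A B ℓ (1 / c) := by
  intro w
  set C := ctrbMatrix A B ℓ with hC
  have hH : (C * Cᵀ).PosDef := by
    refine Matrix.PosDef.of_dotProduct_mulVec_pos ?_ fun y hy => ?_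
    · simpa [Matrix.conjTranspose_eq_transpose_of_trivial] using
        Matrix.isHermitian_mul_conjTranspose_self C
    · rw [star_trivial, ← Matrix.mulVec_mulVec, Matrix.dotProduct_mulVec,
        ← Matrix.mulVec_transpose, ← vnorm_sq]
      refine lt_of_lt_of_le ?_ (h y)
      have : vnorm y ≠ 0 := fun h0 => hy (vnorm_eq_zero.1 h0)
      positivity
  set z := (C * Cᵀ)⁻¹ *ᵥ w with hz
  set D := Cᵀ *ᵥ z with hD
  have hCD : C *ᵥ D = w := by
    rw [hD, Matrix.mulVec_mulVec, hz, Matrix.mulVec_mulVec,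
      Matrix.mul_nonsing_inv _ ((Matrix.isUnit_iff_isUnit_det _).1 hH.isUnit), Matrix.one_mulVec]
  have hDn : vnorm D ^ 2 ≤ (1 / c) ^ 2 * vnorm w ^ 2 := by
    have h1 : vnorm D ^ 2 ≤ vnorm z * vnorm w := by
      rw [vnorm_sq]
      nth_rw 1 [hD]
      rw [Matrix.mulVec_transpose, ← Matrix.dotProduct_mulVec, hCD]
      exact dotProduct_le_vnorm _ _
    have h2 : c * vnorm z ≤ vnorm D := by
      refine le_of_sq_le_sq ?_ (vnorm_nonneg _)
      rw [mul_pow]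
      exact h z
    have h3 : c * vnorm D ≤ vnorm w := by
      rcases (vnorm_nonneg D).eq_or_lt with h0 | h0
      · rw [← h0, mul_zero]; exact vnorm_nonneg _
      · refine le_of_mul_le_mul_left ?_ h0
        nlinarith [mul_le_mul_of_nonneg_right h2 (vnorm_nonneg w)]
    have h4 : vnorm D ≤ 1 / c * vnorm w := by
      rw [one_div, inv_mul_eq_div, le_div_iff₀ hc]
      linarith
    rw [← mul_pow]
    exact pow_le_pow_left₀ (vnorm_nonneg _) h4 2
  set D' : ℕ → Fin d → ℝ := fun i j => if hi : i < ℓ then D (⟨i, hi⟩, j) else 0 with hD'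
  have hD'i : ∀ i : Fin ℓ, D' i = fun j => D (i, j) := fun i => by simp [hD']
  -- Block `i` of the controllability matrix carries `A ^ i`, which acts on the input at time `ℓ - 1
  -- - i`.
  refine ⟨fun i => D' (ℓ - 1 - i), ?_, ?_⟩
  · rw [Finset.sum_range_reflect (fun i => A ^ i *ᵥ (B *ᵥ D' i)) ℓ, Finset.sum_range, ← hCD, hC,
      ctrbMatrix_mulVec]
    simp_rw [hD'i]
  · rw [Finset.sum_range_reflect (fun i => vnorm (D' i) ^ 2) ℓ, Finset.sum_range]
    simp_rw [hD'i]
    rwa [← vnorm_sq_prod]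

lemma IsControllable.le_vnorm {ℓ : ℕ} {ν : ℝ≥0} (h : IsControllable A B ℓ ν) (y : Fin n → ℝ) :
    (ν : ℝ) ^ 2 * vnorm y ^ 2 ≤ vnorm ((ctrbMatrix A B ℓ)ᵀ *ᵥ y) ^ 2 := by
  refine le_trans ?_ (sigmaMin_sq_mul_le _ y)
  have := h.2
  gcongr

/-- Each of the `ℓ` blocks moves by at most `η`, so the whole matrix moves by at most `√ℓ η ≤ ν /
2`, and the triangle inequality leaves `ν / 2`. -/
lemma le_vnorm_ctrbMatrix_of_perturb {ℓ : ℕ} {ν η : ℝ} (hν : 0 ≤ ν)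
    (h : ∀ y, ν ^ 2 * vnorm y ^ 2 ≤ vnorm ((ctrbMatrix A B ℓ)ᵀ *ᵥ y) ^ 2)
    (hη : ∀ i < ℓ, ‖A' ^ i * B' - A ^ i * B‖ ≤ η) (hℓη : ℓ * η ^ 2 ≤ (ν / 2) ^ 2)
    (y : Fin n → ℝ) :
    (ν / 2) ^ 2 * vnorm y ^ 2 ≤ vnorm ((ctrbMatrix A' B' ℓ)ᵀ *ᵥ y) ^ 2 := by
  have h1 : vnorm ((ctrbMatrix A' B' ℓ)ᵀ *ᵥ y - (ctrbMatrix A B ℓ)ᵀ *ᵥ y) ^ 2 ≤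
      (ν / 2 * vnorm y) ^ 2 := by
    rw [vnorm_sq_prod]
    calc _ ≤ ∑ _i : Fin ℓ, (η * vnorm y) ^ 2 := by
          refine Finset.sum_le_sum fun i _ => ?_
          refine pow_le_pow_left₀ (vnorm_nonneg _) ?_ 2
          have h2 : (fun j => ((ctrbMatrix A' B' ℓ)ᵀ *ᵥ y - (ctrbMatrix A B ℓ)ᵀ *ᵥ y) (i, j)) =
              (A' ^ (i : ℕ) * B' - A ^ (i : ℕ) * B)ᵀ *ᵥ y := by
            rw [Matrix.transpose_sub, Matrix.sub_mulVec]
            rfl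
          rw [h2]
          refine (vnorm_mulVec_le _ _).trans ?_
          rw [norm_transpose_real]
          exact mul_le_mul_of_nonneg_right (hη i i.2) (vnorm_nonneg _)
      _ = (ℓ * η ^ 2) * vnorm y ^ 2 := by
          rw [Finset.sum_const, Finset.card_univ, Fintype.card_fin, nsmul_eq_mul]
          ring
      _ ≤ (ν / 2) ^ 2 * vnorm y ^ 2 := by gcongr
      _ = _ := by ring
  have h3 := le_of_sq_le_sq h1 (mul_nonneg (by positivity) (vnorm_nonneg y))
  have h4 : ν * vnorm y ≤ vnorm ((ctrbMatrix A B ℓ)ᵀ *ᵥ y) := by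
    refine le_of_sq_le_sq ?_ (vnorm_nonneg _)
    rw [mul_pow]
    exact h y
  have h5 := vnorm_sub_le ((ctrbMatrix A' B' ℓ)ᵀ *ᵥ y)
    ((ctrbMatrix A' B' ℓ)ᵀ *ᵥ y - (ctrbMatrix A B ℓ)ᵀ *ᵥ y)
  rw [sub_sub_cancel] at h5
  rw [← mul_pow]
  refine pow_le_pow_left₀ (mul_nonneg (by positivity) (vnorm_nonneg y)) ?_ 2
  linarith

/-- The response at time `t` to the disturbances `w`. -/
def response (A : Matrix (Fin n) (Fin n) ℝ) (w : ℕ → Fin n → ℝ) (t : ℕ) : Fin n → ℝ :=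
  ∑ i ∈ Finset.range t, A ^ (t - 1 - i) *ᵥ w i

lemma response_succ (A : Matrix (Fin n) (Fin n) ℝ) (w : ℕ → Fin n → ℝ) (t : ℕ) :
    response A w (t + 1) = A *ᵥ response A w t + w t := by
  rw [response, response, Finset.sum_range_succ, Matrix.mulVec_sum]
  congr 1
  · refine Finset.sum_congr rfl fun i hi => ?_
    have : t + 1 - 1 - i = (t - 1 - i) + 1 := by have := Finset.mem_range.1 hi; lia
    rw [this, pow_succ', Matrix.mulVec_mulVec]
  · simp

lemma vnorm_response_le {ℓ : ℕ} {M : ℝ} (hM : ∀ k < ℓ, ‖A ^ k‖ ≤ M) (w : ℕ → Fin n → ℝ) {t : ℕ}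
    (ht : t ≤ ℓ) : vnorm (response A w t) ≤ M * ∑ i ∈ Finset.range ℓ, vnorm (w i) := by
  rcases ℓ.eq_zero_or_pos with rfl | hℓ
  · simp [Nat.le_zero.1 ht, response, vnorm_zero]
  have hM0 : 0 ≤ M := (norm_nonneg _).trans (hM 0 hℓ)
  calc vnorm (response A w t) ≤ ∑ i ∈ Finset.range t, vnorm (A ^ (t - 1 - i) *ᵥ w i) :=
        vnorm_sum_le _ _
    _ ≤ ∑ i ∈ Finset.range t, M * vnorm (w i) := by
        refine Finset.sum_le_sum fun i hi => (vnorm_mulVec_le _ _).trans ?_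
        have := Finset.mem_range.1 hi
        exact mul_le_mul_of_nonneg_right (hM _ (by lia)) (vnorm_nonneg _)
    _ ≤ ∑ i ∈ Finset.range ℓ, M * vnorm (w i) :=
        Finset.sum_le_sum_of_subset_of_nonneg (Finset.range_mono ht)
          fun i _ _ => mul_nonneg hM0 (vnorm_nonneg _)
    _ = _ := (Finset.mul_sum _ _ _).symm

lemma Steers.exists_trajectory {ℓ : ℕ} {g : ℝ} (h : Steers A B ℓ g) (x₀ : Fin n → ℝ) :
    ∃ x u, IsTrajectory A B x u ∧ x 0 = x₀ ∧ x ℓ = 0 := by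
  obtain ⟨δ, hδ, -⟩ := h (-(A ^ ℓ *ᵥ x₀))
  refine ⟨fun t => A ^ t *ᵥ x₀ + response A (fun i => B *ᵥ δ i) t, δ, fun t => ?_, ?_, ?_⟩
  · simp only [response_succ, Matrix.mulVec_add, pow_succ', Matrix.mulVec_mulVec, add_assoc]
  · simp [response]
  · simp only [response, hδ, add_neg_cancel]

/-- A trajectory of one system is shadowed by a trajectory of a nearby system that has the same
state at times `0` and `ℓ`. -/
lemma exists_shadowing {ℓ : ℕ} {g ε M b : ℝ} (hA : ‖A' - A‖ ≤ ε) (hB : ‖B' - B‖ ≤ ε)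
    (hM : ∀ k < ℓ, ‖A' ^ k‖ ≤ M) (hb : ‖B'‖ ≤ b) (hM0 : 0 ≤ M)
    (hsteer : Steers A' B' ℓ g) {x : ℕ → Fin n → ℝ} {u : ℕ → Fin d → ℝ}
    (hx : IsTrajectory A B x u) :
    ∃ (e : ℕ → Fin n → ℝ) (δ : ℕ → Fin d → ℝ), e 0 = 0 ∧ e ℓ = 0 ∧
      IsTrajectory A' B' (fun t => x t + e t) (fun t => u t + δ t) ∧
      ∑ t ∈ Finset.range ℓ, (vnorm (e t) ^ 2 + vnorm (δ t) ^ 2) ≤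
        (2 * ℓ * (1 + ℓ * b ^ 2 * g ^ 2 * M ^ 2) + g ^ 2) * M ^ 2 * (2 * ℓ * ε ^ 2) *
          ∑ t ∈ Finset.range ℓ, (vnorm (x t) ^ 2 + vnorm (u t) ^ 2) := by
  have hb0 : 0 ≤ b := (norm_nonneg _).trans hb
  have hε : 0 ≤ ε := (norm_nonneg _).trans hA
  -- The deviation must obey `e (t + 1) = A' e t + w t + B' δ t`. Choosing `δ` to steer to minus the
  -- response to `w` makes it vanish at time `ℓ`.
  set w : ℕ → Fin n → ℝ := fun t => (A' - A) *ᵥ x t + (B' - B) *ᵥ u t with hw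
  obtain ⟨δ, hδ, hδn⟩ := hsteer (-response A' w ℓ)
  set f : ℕ → Fin n → ℝ := fun t => w t + B' *ᵥ δ t with hf
  set W := ∑ i ∈ Finset.range ℓ, vnorm (w i) with hW
  set D := ∑ i ∈ Finset.range ℓ, vnorm (δ i) with hD
  have hW0 : 0 ≤ W := Finset.sum_nonneg fun i _ => vnorm_nonneg _
  have hD0 : 0 ≤ D := Finset.sum_nonneg fun i _ => vnorm_nonneg _
  have hδ2 : ∑ i ∈ Finset.range ℓ, vnorm (δ i) ^ 2 ≤ g ^ 2 * (M ^ 2 * W ^ 2) := by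
    refine hδn.trans (mul_le_mul_of_nonneg_left ?_ (sq_nonneg g))
    rw [vnorm_neg, ← mul_pow]
    exact pow_le_pow_left₀ (vnorm_nonneg _) (vnorm_response_le hM w le_rfl) 2
  have hD2 : D ^ 2 ≤ ℓ * (g ^ 2 * (M ^ 2 * W ^ 2)) := by
    have h1 := sq_sum_le_card_mul_sum_sq (s := Finset.range ℓ) (f := fun i => vnorm (δ i))
    rw [Finset.card_range] at h1
    exact h1.trans (mul_le_mul_of_nonneg_left hδ2 (Nat.cast_nonneg _))
  have hW2 : W ^ 2 ≤ 2 * ℓ * ε ^ 2 *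
      ∑ t ∈ Finset.range ℓ, (vnorm (x t) ^ 2 + vnorm (u t) ^ 2) := by
    have h1 := sq_sum_le_card_mul_sum_sq (s := Finset.range ℓ) (f := fun i => vnorm (w i))
    rw [Finset.card_range] at h1
    refine h1.trans ?_
    have h2 : ∑ i ∈ Finset.range ℓ, vnorm (w i) ^ 2 ≤
        ∑ i ∈ Finset.range ℓ, 2 * ε ^ 2 * (vnorm (x i) ^ 2 + vnorm (u i) ^ 2) := by
      refine Finset.sum_le_sum fun i _ => ?_
      have h3 : vnorm (w i) ≤ ε * vnorm (x i) + ε * vnorm (u i) := by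
        refine (vnorm_add_le _ _).trans (add_le_add ?_ ?_)
        · exact (vnorm_mulVec_le _ _).trans (mul_le_mul_of_nonneg_right hA (vnorm_nonneg _))
        · exact (vnorm_mulVec_le _ _).trans (mul_le_mul_of_nonneg_right hB (vnorm_nonneg _))
      refine (pow_le_pow_left₀ (vnorm_nonneg _) h3 2).trans ?_
      refine (add_sq_le (a := ε * vnorm (x i))).trans_eq ?_
      ring
    rw [← Finset.mul_sum] at h2
    refine (mul_le_mul_of_nonneg_left h2 (Nat.cast_nonneg ℓ)).trans_eq ?_
    ring
  have hsum : ∑ i ∈ Finset.range ℓ, vnorm (f i) ≤ W + b * D := by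
    rw [hW, hD, Finset.mul_sum, ← Finset.sum_add_distrib]
    refine Finset.sum_le_sum fun i _ => (vnorm_add_le _ _).trans ?_
    gcongr
    exact (vnorm_mulVec_le _ _).trans (mul_le_mul_of_nonneg_right hb (vnorm_nonneg _))
  have he2 : ∀ t ∈ Finset.range ℓ, vnorm (response A' f t) ^ 2 ≤
      2 * (1 + ℓ * b ^ 2 * g ^ 2 * M ^ 2) * (M ^ 2 * W ^ 2) := by
    intro t ht
    have h1 := (vnorm_response_le hM f (Finset.mem_range.1 ht).le).trans
      (mul_le_mul_of_nonneg_left hsum hM0)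
    refine (pow_le_pow_left₀ (vnorm_nonneg _) h1 2).trans ?_
    calc (M * (W + b * D)) ^ 2 = M ^ 2 * (W + b * D) ^ 2 := by ring
      _ ≤ M ^ 2 * (2 * (W ^ 2 + (b * D) ^ 2)) := by gcongr; exact add_sq_le
      _ = M ^ 2 * (2 * (W ^ 2 + b ^ 2 * D ^ 2)) := by ring
      _ ≤ M ^ 2 * (2 * (W ^ 2 + b ^ 2 * (ℓ * (g ^ 2 * (M ^ 2 * W ^ 2))))) := by gcongr
      _ = _ := by ring
  refine ⟨response A' f, δ, by simp [response], ?_, fun t => ?_, ?_⟩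
  · have h1 : response A' f ℓ = response A' w ℓ +
        ∑ i ∈ Finset.range ℓ, A' ^ (ℓ - 1 - i) *ᵥ (B' *ᵥ δ i) := by
      simp only [response, hf, Matrix.mulVec_add, Finset.sum_add_distrib]
    rw [h1, hδ, add_neg_cancel]
  · simp only [response_succ, hf, hw, hx t, Matrix.mulVec_add, Matrix.sub_mulVec]
    abel
  -- The `ℓ` state deviations contribute `2 ℓ (1 + ℓ b² g² M²)` and the input corrections `g²`, both
  -- times `M² W²`; `hW2` then bounds `W²`.
  · rw [Finset.sum_add_distrib]
    refine (add_le_add (Finset.sum_le_sum he2) hδ2).trans ?_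
    rw [Finset.sum_const, Finset.card_range, nsmul_eq_mul]
    calc _ = (2 * ℓ * (1 + ℓ * b ^ 2 * g ^ 2 * M ^ 2) + g ^ 2) * M ^ 2 * W ^ 2 := by ring
      _ ≤ _ := by
        rw [mul_assoc (_ * M ^ 2)]
        gcongr

/-- Comparison of the optimal costs of two nearby systems. -/
lemma quadForm_le_of_shadowing {Q P P' : Matrix (Fin n) (Fin n) ℝ} {R : Matrix (Fin d) (Fin d) ℝ}
    (hQ : Q.PosDef) (hR : R.PosDef) {ℓ : ℕ} (hℓ : 1 ≤ ℓ) {g ε M b : ℝ}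
    (hA : ‖A' - A‖ ≤ ε) (hB : ‖B' - B‖ ≤ ε)
    (hM : ∀ k < ℓ, ‖A' ^ k‖ ≤ M) (hb : ‖B'‖ ≤ b) (hM0 : 0 ≤ M)
    (hsteer : Steers A' B' ℓ g) (hP : IsRiccatiSolution A B Q R P)
    (hP' : IsRiccatiSolution A' B' Q R P') {S s : ℝ} (hs : 0 < s) (hsQ : s ≤ sigmaMin Q)
    (hsR : s ≤ sigmaMin R) (hSQ : ‖Q‖ ≤ S) (hSR : ‖R‖ ≤ S) {c : ℝ}
    (hc : (2 * ℓ * (1 + ℓ * b ^ 2 * g ^ 2 * M ^ 2) + g ^ 2) * M ^ 2 * (2 * ℓ * ε ^ 2) ≤ c)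
    {θ : ℝ} (hθ : 0 < θ) (x : Fin n → ℝ) :
    quadForm P' x ≤ (1 + θ + (1 + 1 / θ) * (S * (c / s))) * quadForm P x := by
  have hS0 : 0 ≤ S := (norm_nonneg _).trans hSQ
  have hc0 : 0 ≤ c := le_trans (by positivity) hc
  refine hP.quadForm_le_mul hQ hR hℓ (by positivity) (fun x u hx => ?_) x
  -- The shadowing block competes for `P'`. Its endpoints are those of `x`, so only the running cost
  -- has to be compared.
  obtain ⟨e, δ, he0, heℓ, htraj, hbound⟩ := exists_shadowing hA hB hM hb hM0 hsteer hx
  have h1 := hP'.quadForm_le hR htraj ℓ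
  simp only [he0, heℓ, add_zero] at h1
  refine h1.trans (add_le_add ?_ le_rfl)
  have hstage : ∀ t ∈ Finset.range ℓ, stageCost Q R (x t + e t) (u t + δ t) ≤
      (1 + θ) * stageCost Q R (x t) (u t) +
        (1 + 1 / θ) * S * (vnorm (e t) ^ 2 + vnorm (δ t) ^ 2) := by
    intro t _
    have h2 := quadForm_add_le hQ.posSemidef hθ (x t) (e t)
    have h3 := quadForm_add_le hR.posSemidef hθ (u t) (δ t)
    have h4 : quadForm Q (e t) ≤ S * vnorm (e t) ^ 2 := (quadForm_le_norm _ _).trans (by gcongr)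
    have h5 : quadForm R (δ t) ≤ S * vnorm (δ t) ^ 2 := (quadForm_le_norm _ _).trans (by gcongr)
    have h6 : 0 ≤ 1 + 1 / θ := by positivity
    have h7 := mul_le_mul_of_nonneg_left (add_le_add h4 h5) h6
    simp only [stageCost]
    linarith
  have hE : ∑ t ∈ Finset.range ℓ, (vnorm (x t) ^ 2 + vnorm (u t) ^ 2) ≤
      (∑ t ∈ Finset.range ℓ, stageCost Q R (x t) (u t)) / s := by
    rw [le_div_iff₀ hs, Finset.sum_mul]
    refine Finset.sum_le_sum fun t _ => ?_
    have h2 := sigmaMin_mul_le_quadForm hQ.posSemidef (x t)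
    have h3 := sigmaMin_mul_le_quadForm hR.posSemidef (u t)
    have h4 := mul_le_mul_of_nonneg_right hsQ (sq_nonneg (vnorm (x t)))
    have h5 := mul_le_mul_of_nonneg_right hsR (sq_nonneg (vnorm (u t)))
    rw [stageCost]
    linarith
  have hE0 : 0 ≤ ∑ t ∈ Finset.range ℓ, (vnorm (x t) ^ 2 + vnorm (u t) ^ 2) :=
    Finset.sum_nonneg fun t _ => by positivity
  have hfin : ∑ t ∈ Finset.range ℓ, (vnorm (e t) ^ 2 + vnorm (δ t) ^ 2) ≤
      c * ((∑ t ∈ Finset.range ℓ, stageCost Q R (x t) (u t)) / s) :=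
    (hbound.trans (mul_le_mul_of_nonneg_right hc hE0)).trans (mul_le_mul_of_nonneg_left hE hc0)
  refine (Finset.sum_le_sum hstage).trans ?_
  rw [Finset.sum_add_distrib, ← Finset.mul_sum, ← Finset.mul_sum]
  have h8 := mul_le_mul_of_nonneg_left hfin (show 0 ≤ (1 + 1 / θ) * S by positivity)
  refine (add_le_add le_rfl h8).trans_eq ?_
  field_simp

end steering

/-! ### The perturbation bound -/

section perturbation

variable {n d : ℕ} {A A' : Matrix (Fin n) (Fin n) ℝ} {B B' : Matrix (Fin n) (Fin d) ℝ}
  {Q P P' : Matrix (Fin n) (Fin n) ℝ} {R : Matrix (Fin d) (Fin d) ℝ}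

lemma sigmaMin_of_isEmpty {m k : Type*} [Fintype m] [DecidableEq m] [Fintype k] [IsEmpty m]
    (M : Matrix m k ℝ) : sigmaMin M = 0 := by
  simp [sigmaMin]

/-- Where `P'` is the smaller form, the gap is at most `c` times `P'`, hence at most `c` times `P`;
so `‖P‖` alone suffices on the right. -/
lemma norm_sub_le_of_quadForm_le (hP : P.PosSemidef) (hP' : P'.PosSemidef) {c : ℝ} (hc : 0 ≤ c)
    (h₁ : ∀ x, quadForm P' x ≤ (1 + c) * quadForm P x)
    (h₂ : ∀ x, quadForm P x ≤ (1 + c) * quadForm P' x) : ‖P' - P‖ ≤ c * ‖P‖ := by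
  refine norm_le_of_abs_quadForm_le (hP'.1.sub hP.1) (mul_nonneg hc (norm_nonneg _)) fun x => ?_
  rw [quadForm_sub_matrix, mul_assoc]
  have h3 := mul_le_mul_of_nonneg_left (quadForm_le_norm P x) hc
  refine le_trans ?_ h3
  have h4 := h₁ x
  have h5 := h₂ x
  have h6 := hP.quadForm_nonneg x
  rcases le_total (quadForm P x) (quadForm P' x) with h | h
  · rw [abs_of_nonneg (by linarith)]
    linarith
  · rw [abs_of_nonpos (by linarith)]
    have := mul_le_mul_of_nonneg_left h hc
    linarith

lemma IsRiccatiSolution.sigmaMin_le_norm [Nonempty (Fin n)] (h : IsRiccatiSolution A B Q R P)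
    (hQ : Q.PosDef) (hR : R.PosDef) : sigmaMin Q ≤ ‖P‖ := by
  obtain ⟨i⟩ := ‹Nonempty (Fin n)›
  have h1 : vnorm (Pi.single i (1 : ℝ)) = 1 := by simp [vnorm]
  simpa [h1] using (sigmaMin_mul_le_quadForm hQ.posSemidef (Pi.single i 1)).trans
    ((h.quadForm_stateCost_le hR _).trans (quadForm_le_norm _ _))

lemma Steers.existsUnique {ℓ : ℕ} {g : ℝ} (h : Steers A B ℓ g) (hQ : Q.PosDef) (hR : R.PosDef) :
    ∃! P, IsRiccatiSolution A B Q R P := by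
  obtain ⟨P, hP⟩ := exists_isRiccatiSolution hQ hR h.exists_trajectory
  exact ⟨P, hP, fun P' hP' => hP'.unique hQ hR hP⟩

lemma isRiccatiSolution_dare (h : ∃! P, IsRiccatiSolution A B Q R P) :
    IsRiccatiSolution A B Q R (dare A B Q R) := by
  rw [dare, dif_pos h.exists]
  exact h.exists.choose_spec

/-- Here `L = ℓ^(5/2)`, `y = β^(ℓ-1)`, `Z = 1 + 1/ν`, `b = 1 + ‖B‖` and `g = 2/ν`. The three terms
of the bracket are at most `8`, `2` and `4` times one monomial, and `28 = 2 * 14`. -/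
lemma shadowing_const_le {ℓ b T y Z ε L g : ℝ} (hℓ : 1 ≤ ℓ) (hb : 1 ≤ b) (hT : 1 ≤ T) (hy : 1 ≤ y)
    (hZ : 1 ≤ Z) (hL : L ^ 2 = ℓ ^ 5) (hg : g ^ 2 ≤ 4 * Z ^ 2) :
    (2 * ℓ * (1 + ℓ * b ^ 2 * g ^ 2 * (T * y) ^ 2) + g ^ 2) * (T * y) ^ 2 * (2 * ℓ * ε ^ 2) ≤
      28 * (ε * L * T ^ 3 * y ^ 2 * Z * b ^ 2) ^ 2 := by
  have hbr : 2 * ℓ * (1 + ℓ * b ^ 2 * g ^ 2 * (T * y) ^ 2) + g ^ 2 ≤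
      14 * (ℓ ^ 2 * b ^ 2 * (T * y) ^ 2 * Z ^ 2) := by
    have h1 : 2 * ℓ * (ℓ * b ^ 2 * g ^ 2 * (T * y) ^ 2) ≤
        8 * (ℓ ^ 2 * b ^ 2 * (T * y) ^ 2 * Z ^ 2) := by
      calc _ = 2 * (ℓ ^ 2 * b ^ 2 * (T * y) ^ 2) * g ^ 2 := by ring
        _ ≤ 2 * (ℓ ^ 2 * b ^ 2 * (T * y) ^ 2) * (4 * Z ^ 2) := by gcongr
        _ = _ := by ring
    have h2 : 2 * ℓ ≤ 2 * (ℓ ^ 2 * b ^ 2 * (T * y) ^ 2 * Z ^ 2) := by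
      have h3 : 1 ≤ ℓ * b ^ 2 * (T * y) ^ 2 * Z ^ 2 :=
        one_le_mul_of_one_le_of_one_le (one_le_mul_of_one_le_of_one_le
          (one_le_mul_of_one_le_of_one_le hℓ (one_le_pow₀ hb))
          (one_le_pow₀ (one_le_mul_of_one_le_of_one_le hT hy))) (one_le_pow₀ hZ)
      calc 2 * ℓ = 2 * ℓ * 1 := by ring
        _ ≤ 2 * ℓ * (ℓ * b ^ 2 * (T * y) ^ 2 * Z ^ 2) := by gcongr
        _ = _ := by ring
    have h4 : g ^ 2 ≤ 4 * (ℓ ^ 2 * b ^ 2 * (T * y) ^ 2 * Z ^ 2) := by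
      have h3 : 1 ≤ ℓ ^ 2 * b ^ 2 * (T * y) ^ 2 :=
        one_le_mul_of_one_le_of_one_le
          (one_le_mul_of_one_le_of_one_le (one_le_pow₀ hℓ) (one_le_pow₀ hb))
          (one_le_pow₀ (one_le_mul_of_one_le_of_one_le hT hy))
      refine hg.trans ?_
      have := mul_le_mul_of_nonneg_right h3 (sq_nonneg Z)
      linarith
    linarith
  calc _ ≤ 14 * (ℓ ^ 2 * b ^ 2 * (T * y) ^ 2 * Z ^ 2) * (T * y) ^ 2 * (2 * ℓ * ε ^ 2) := by gcongr
    _ = 28 * (ε ^ 2 * y ^ 4 * Z ^ 2 * (ℓ ^ 3 * T ^ 4 * b ^ 2)) := by ring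
    _ ≤ 28 * (ε ^ 2 * y ^ 4 * Z ^ 2 * (ℓ ^ 5 * T ^ 6 * b ^ 4)) := by
      gcongr <;> first | assumption | norm_num
    _ = _ := by rw [← hL]; ring

/-- As `ν Z = ν + 1 ≥ 1`, a factor `(ν Z)²` can be inserted; this turns an absolute smallness
condition into one proportional to `ν`. -/
lemma ctrb_const_le {ℓ b T y Z ε L ν : ℝ} (hℓ : 1 ≤ ℓ) (hb : 1 ≤ b) (hT : 1 ≤ T) (hy : 1 ≤ y)
    (hν : 0 < ν) (hZ : Z = 1 + 1 / ν) (hL : L ^ 2 = ℓ ^ 5)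
    (hμ0 : 0 ≤ ε * L * T ^ 3 * y ^ 2 * Z * b ^ 2) (hμ : ε * L * T ^ 3 * y ^ 2 * Z * b ^ 2 ≤ 1 / 32) :
    ℓ * (ℓ * T * (T * y) * ε * b) ^ 2 ≤ (ν / 2) ^ 2 := by
  have hνZ : 1 ≤ ν * Z := by
    rw [hZ, mul_add, mul_one_div_cancel hν.ne']
    linarith
  have h1 : (ε * L * T ^ 3 * y ^ 2 * Z * b ^ 2) ^ 2 ≤ (1 / 32) ^ 2 := pow_le_pow_left₀ hμ0 hμ 2
  calc ℓ * (ℓ * T * (T * y) * ε * b) ^ 2 = ε ^ 2 * (ℓ ^ 3 * T ^ 4 * y ^ 2 * b ^ 2) * 1 := by ring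
    _ ≤ ε ^ 2 * (ℓ ^ 5 * T ^ 6 * y ^ 4 * b ^ 4) * (ν * Z) ^ 2 := by
      gcongr <;> first | assumption | exact one_le_pow₀ hνZ | norm_num
    _ = ν ^ 2 * (ε * L * T ^ 3 * y ^ 2 * Z * b ^ 2) ^ 2 := by
      rw [← hL]
      ring
    _ ≤ ν ^ 2 * (1 / 32) ^ 2 := by gcongr
    _ ≤ (ν / 2) ^ 2 := by linarith [sq_nonneg ν]

/-- The perturbation theorem in real numbers, for `ε > 0` and finite `T`. The square of `μ` is the
scale of the shadowing constant. -/
lemma exists_riccati_of_perturb [Nonempty (Fin n)] [Nonempty (Fin d)]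
    (hQ : Q.PosDef) (hR : R.PosDef) (hR1 : 1 ≤ sigmaMin R) {ℓ : ℕ}
    {ν : ℝ≥0} (hν : 0 < ν) (hctrb : IsControllable A B ℓ ν) {ε T ρ β L μ : ℝ} (hε : 0 < ε)
    (hT1 : 1 ≤ T) (hρ : 0 ≤ ρ) (hT : ∀ k, ‖A ^ k‖ ≤ T * ρ ^ k) (hβ1 : 1 ≤ β)
    (hβ : ε * T + ρ ≤ β) (hL0 : 0 ≤ L) (hL : L ^ 2 = (ℓ : ℝ) ^ 5)
    (hA : ‖A' - A‖ ≤ ε) (hB : ‖B' - B‖ ≤ ε) (hP : IsRiccatiSolution A B Q R P)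
    (hμdef : μ = ε * L * T ^ 3 * (β ^ (ℓ - 1)) ^ 2 * (1 + 1 / (ν : ℝ)) * (1 + ‖B‖) ^ 2)
    (hμ : 32 * μ * ‖P‖ * (max ‖Q‖ ‖R‖ / min (sigmaMin R) (sigmaMin Q)) ≤ 1) :
    (∃! P', IsRiccatiSolution A' B' Q R P') ∧ ∀ P', IsRiccatiSolution A' B' Q R P' →
      ‖P' - P‖ ≤ 32 * μ * ‖P‖ * (max ‖Q‖ ‖R‖ / min (sigmaMin R) (sigmaMin Q)) := by
  set S := max ‖Q‖ ‖R‖ with hS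
  set s := min (sigmaMin R) (sigmaMin Q) with hs
  set y := β ^ (ℓ - 1) with hy
  set Z := 1 + 1 / (ν : ℝ) with hZ
  set b := 1 + ‖B‖ with hb
  have hν' : (0 : ℝ) < ν := NNReal.coe_pos.2 hν
  have hℓ : 1 ≤ ℓ := hctrb.1
  have hℓ' : (1 : ℝ) ≤ ℓ := by exact_mod_cast hℓ
  have hy1 : 1 ≤ y := one_le_pow₀ hβ1
  have hZ1 : 1 ≤ Z := by rw [hZ]; linarith [one_div_pos.2 hν']
  have hb1 : 1 ≤ b := by rw [hb]; linarith [norm_nonneg B]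
  have hL1 : 1 ≤ L := by
    by_contra! h
    have h1 : L ^ 2 < 1 := pow_lt_one₀ hL0 h two_ne_zero
    linarith [one_le_pow₀ (n := 5) hℓ']
  have hs0 : 0 < s := lt_min (zero_lt_one.trans_le hR1) (sigmaMin_pos hQ)
  have hS1 : 1 ≤ S := (hR1.trans (sigmaMin_le_norm hR.posSemidef)).trans (le_max_right _ _)
  have hsP : s ≤ ‖P‖ := (min_le_right _ _).trans (hP.sigmaMin_le_norm hQ hR)
  have hκ1 : 1 ≤ S / s := by
    rw [one_le_div hs0]
    exact (min_le_left _ _).trans ((sigmaMin_le_norm hR.posSemidef).trans (le_max_right _ _))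
  -- This is where `σ_min(R) ≥ 1` enters, through `S ≥ 1`. It makes the smallness of the full bound
  -- imply `μ ≤ 1/32`.
  have hPκ : 1 ≤ ‖P‖ * (S / s) := by
    rw [← mul_div_assoc, one_le_div hs0]
    exact hsP.trans (le_mul_of_one_le_right (norm_nonneg _) hS1)
  -- Together with `μ ≤ 1/32` this gives `ε ≤ 1`, so that `b = 1 + ‖B‖` also bounds `‖B'‖`.
  have hεμ : ε ≤ μ := by
    have : 1 ≤ L * T ^ 3 * y ^ 2 * Z * b ^ 2 :=
      one_le_mul_of_one_le_of_one_le (one_le_mul_of_one_le_of_one_le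
        (one_le_mul_of_one_le_of_one_le (one_le_mul_of_one_le_of_one_le hL1 (one_le_pow₀ hT1))
          (one_le_pow₀ hy1)) hZ1) (one_le_pow₀ hb1)
    calc ε = ε * 1 := (mul_one _).symm
      _ ≤ ε * (L * T ^ 3 * y ^ 2 * Z * b ^ 2) := by gcongr
      _ = μ := by rw [hμdef]; ring
  have hμ0 : 0 < μ := hε.trans_le hεμ
  have hμ32 : μ ≤ 1 / 32 := by
    have : 32 * μ * 1 ≤ 32 * μ * (‖P‖ * (S / s)) := by gcongr
    linarith
  have hpow : ∀ {k}, k < ℓ → ∀ γ, 0 ≤ γ → γ ≤ β → T * γ ^ k ≤ T * y := by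
    intro k hk γ hγ0 hγ
    refine mul_le_mul_of_nonneg_left ?_ (by linarith)
    exact (pow_le_pow_left₀ hγ0 hγ k).trans (pow_le_pow_right₀ hβ1 (by lia))
  have hεT : 0 ≤ ε * T := by positivity
  have hM : ∀ k < ℓ, ‖A ^ k‖ ≤ T * y := fun k hk => (hT k).trans (hpow hk ρ hρ (by linarith))
  have hM' : ∀ k < ℓ, ‖A' ^ k‖ ≤ T * y := fun k hk =>
    (norm_pow_le_of_perturb hT hA k).trans (hpow hk _ (by positivity) hβ)
  have hbB : ‖B‖ ≤ b := by rw [hb]; linarith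
  have hbB' : ‖B'‖ ≤ b := by
    have : ‖B'‖ ≤ ‖B‖ + ‖B' - B‖ := by simpa using norm_add_le B (B' - B)
    rw [hb]
    linarith
  have hg : (1 / ((ν : ℝ) / 2)) ^ 2 ≤ 4 * Z ^ 2 := by
    have : 1 / ((ν : ℝ) / 2) ≤ 2 * Z := by
      rw [hZ, one_div_div]
      have : (2 : ℝ) / ν = 2 * (1 / ν) := by ring
      linarith
    exact (pow_le_pow_left₀ (by positivity) this 2).trans_eq (by ring)
  have hconst := shadowing_const_le (ε := ε) hℓ' hb1 hT1 hy1 hZ1 hL hg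
  rw [← hμdef] at hconst
  -- The unperturbed pair is given the weaker gain `2/ν` too, so that one constant serves both
  -- directions.
  have hsteer : Steers A B ℓ (1 / ((ν : ℝ) / 2)) := by
    refine steers_of_le_vnorm (by positivity) fun x => le_trans ?_ (hctrb.le_vnorm x)
    gcongr
    linarith
  have hsteer' : Steers A' B' ℓ (1 / ((ν : ℝ) / 2)) := by
    refine steers_of_le_vnorm (by positivity) (le_vnorm_ctrbMatrix_of_perturb hν'.le hctrb.le_vnorm
      (η := ℓ * T * (T * y) * ε * b) (fun i hi => ?_)
      (ctrb_const_le hℓ' hb1 hT1 hy1 hν' hZ hL (by rw [← hμdef]; exact hμ0.le)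
        (by rw [← hμdef]; exact hμ32)))
    have h1 := norm_pow_sub_pow_le_of_perturb hT hA (by linarith) hρ hβ1 hβ hi
    have h2 : A' ^ i * B' - A ^ i * B = A' ^ i * (B' - B) + (A' ^ i - A ^ i) * B := by
      rw [Matrix.mul_sub, Matrix.sub_mul]
      abel
    rw [h2]
    have h3 : ‖A' ^ i * (B' - B)‖ ≤ ℓ * T * ε * (T * y) * 1 := by
      refine (Matrix.l2_opNorm_mul _ _).trans ((mul_le_mul (hM' i hi) hB (norm_nonneg _)
        (by positivity)).trans ?_)
      have : 1 ≤ ℓ * T := one_le_mul_of_one_le_of_one_le hℓ' hT1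
      calc T * y * ε = 1 * (T * y * ε) := (one_mul _).symm
        _ ≤ (ℓ * T) * (T * y * ε) := by gcongr
        _ = _ := by ring
    have h4 : ‖(A' ^ i - A ^ i) * B‖ ≤ ℓ * T * ε * (T * y) * ‖B‖ :=
      (Matrix.l2_opNorm_mul _ _).trans (mul_le_mul_of_nonneg_right h1 (norm_nonneg _))
    refine (norm_add_le _ _).trans ((add_le_add h3 h4).trans_eq ?_)
    rw [hb]
    ring
  refine ⟨hsteer'.existsUnique hQ hR, fun P' hP' => ?_⟩
  set κ := S / s with hκ
  have hκ0 : 0 < κ := by linarith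
  -- With `θ = 4 μ κ` the excess is `4 μ κ + 28 μ² κ + 7 μ`, at most `12 μ κ` because `μ ≤ 1/32` and
  -- `κ ≥ 1`.
  have hθ : 0 < 4 * μ * κ := by positivity
  have hfactor : 1 + 4 * μ * κ + (1 + 1 / (4 * μ * κ)) * (S * (28 * μ ^ 2 / s)) ≤
      1 + 32 * μ * κ := by
    have h1 : S * (28 * μ ^ 2 / s) = 28 * μ ^ 2 * κ := by rw [hκ]; ring
    have h2 : (1 + 1 / (4 * μ * κ)) * (28 * μ ^ 2 * κ) = 28 * μ * (μ * κ) + 7 * μ := by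
      field_simp
      ring
    rw [h1, h2]
    have h3 : 28 * μ * (μ * κ) ≤ 1 * (μ * κ) := by gcongr; linarith
    have h4 : 7 * μ * 1 ≤ 7 * μ * κ := by gcongr
    have h5 : 0 < μ * κ := by positivity
    linarith
  have hle : ∀ x, quadForm P' x ≤ (1 + 32 * μ * κ) * quadForm P x := fun x =>
    (quadForm_le_of_shadowing hQ hR hℓ hA hB hM' hbB' (by positivity) hsteer' hP hP' hs0
      (min_le_right _ _) (min_le_left _ _) (le_max_left _ _) (le_max_right _ _) hconst hθ
      x).trans (mul_le_mul_of_nonneg_right hfactor (hP.1.quadForm_nonneg x))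
  have hle' : ∀ x, quadForm P x ≤ (1 + 32 * μ * κ) * quadForm P' x := fun x =>
    (quadForm_le_of_shadowing hQ hR hℓ (by rwa [norm_sub_rev]) (by rwa [norm_sub_rev]) hM hbB
      (by positivity) hsteer hP' hP hs0
      (min_le_right _ _) (min_le_left _ _) (le_max_left _ _) (le_max_right _ _) hconst hθ
      x).trans (mul_le_mul_of_nonneg_right hfactor (hP'.1.quadForm_nonneg x))
  refine (norm_sub_le_of_quadForm_le hP.1 hP'.1 (by positivity) hle hle').trans_eq ?_
  ring

/-! ### From extended nonnegative reals to reals -/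

lemma norm_pow_le_transient {ρ : ℝ≥0} (h : transient A ρ ≠ ∞) (k : ℕ) :
    ‖A ^ k‖ ≤ (transient A ρ).toReal * (ρ : ℝ) ^ k := by
  have h1 : ‖A ^ k‖ₑ / (ρ : ℝ≥0∞) ^ k ≤ transient A ρ :=
    le_iSup (fun k : ℕ => ‖A ^ k‖ₑ / (ρ : ℝ≥0∞) ^ k) k
  rw [ENNReal.div_le_iff_le_mul (Or.inr h) (Or.inl (by simp))] at h1
  have h2 := ENNReal.toReal_mono (ENNReal.mul_ne_top h (by simp)) h1
  simpa using h2

lemma one_le_transient [Nonempty (Fin n)] (A : Matrix (Fin n) (Fin n) ℝ) (ρ : ℝ≥0) :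
    1 ≤ transient A ρ := by
  refine le_trans ?_ (le_iSup (fun k : ℕ => ‖A ^ k‖ₑ / (ρ : ℝ≥0∞) ^ k) 0)
  have h1 : (1 : ℝ) ≤ ‖(1 : Matrix (Fin n) (Fin n) ℝ)‖ := by
    rw [norm_one]
  rw [pow_zero, pow_zero, div_one, ← ofReal_norm]
  exact ENNReal.one_le_ofReal.2 h1

end perturbation

theorem proposition6 {n d : ℕ}
    (A Ahat : Matrix (Fin n) (Fin n) ℝ) (B Bhat : Matrix (Fin n) (Fin d) ℝ)
    (Q : Matrix (Fin n) (Fin n) ℝ) (R : Matrix (Fin d) (Fin d) ℝ)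
    (hQ : Q.PosDef) (hR : R.PosDef) (hR1 : 1 ≤ sigmaMin R)
    (ℓ : ℕ) (ν ρ ε : ℝ≥0) (hν : 0 < ν) (hctrb : IsControllable A B ℓ ν)
    (hρ : spectralRadius ℂ (A.map (algebraMap ℝ ℂ)) ≤ (ρ : ℝ≥0∞))
    (hA : ‖Ahat - A‖ ≤ (ε : ℝ)) (hB : ‖Bhat - B‖ ≤ (ε : ℝ)) :
    (∃! P, IsRiccatiSolution A B Q R P) ∧
      (dareBound A B Q R (dare A B Q R) ℓ ν ρ ε ≤ 1 →
        (∃! Phat, IsRiccatiSolution Ahat Bhat Q R Phat) ∧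
          ‖dare Ahat Bhat Q R - dare A B Q R‖ₑ ≤
            dareBound A B Q R (dare A B Q R) ℓ ν ρ ε) := by
  have hν' : (0 : ℝ) < ν := NNReal.coe_pos.2 hν
  -- With no rows `sigmaMin` is `0`, which contradicts `ν > 0`; for `d` it contradicts `σ_min(R) ≥
  -- 1`.
  have : Nonempty (Fin n) := by
    by_contra h
    rw [not_nonempty_iff] at h
    have := hctrb.2
    rw [sigmaMin_of_isEmpty] at this
    linarith
  have : Nonempty (Fin d) := by
    by_contra h
    rw [not_nonempty_iff] at h
    rw [sigmaMin_of_isEmpty] at hR1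
    linarith
  have hex : ∃! P, IsRiccatiSolution A B Q R P :=
    (steers_of_le_vnorm hν' hctrb.le_vnorm).existsUnique hQ hR
  refine ⟨hex, fun hle => ?_⟩
  have hP := isRiccatiSolution_dare hex
  -- For `ε = 0` the bound is `0` even when `τ = ∞`, but then the two systems coincide.
  rcases eq_or_ne ε 0 with rfl | hε
  · obtain rfl : Ahat = A := sub_eq_zero.1 (norm_le_zero_iff.1 hA)
    obtain rfl : Bhat = B := sub_eq_zero.1 (norm_le_zero_iff.1 hB)
    exact ⟨hex, by simp⟩
  set P := dare A B Q R
  have hs0 : 0 < min (sigmaMin R) (sigmaMin Q) :=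
    lt_min (zero_lt_one.trans_le hR1) (sigmaMin_pos hQ)
  have hP0 : 0 < ‖P‖ := (sigmaMin_pos hQ).trans_le (hP.sigmaMin_le_norm hQ hR)
  have hR0 : 0 < ‖R‖ := (sigmaMin_pos hR).trans_le (sigmaMin_le_norm hR.posSemidef)
  have hne : dareBound A B Q R P ℓ ν ρ ε ≠ ∞ := (hle.trans_lt ENNReal.one_lt_top).ne
  have hℓ0 : (ℓ : ℝ≥0∞) ^ (5 / 2 : ℝ) ≠ 0 := by
    have : ℓ ≠ 0 := by have := hctrb.1; lia
    simp [ENNReal.rpow_eq_zero_iff, this]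
  -- For `ε > 0` no other factor of the bound vanishes, so an infinite `τ` would make it infinite.
  have hτ : transient A ρ ≠ ∞ := by
    intro htop
    refine hne ?_
    have h1 : (32 : ℝ≥0∞) * ε * (ℓ : ℝ≥0∞) ^ (5 / 2 : ℝ) * transient A ρ ^ 3 = ∞ := by
      rw [htop, ENNReal.top_pow three_ne_zero]
      exact ENNReal.mul_top (mul_ne_zero (mul_ne_zero (by norm_num) (by simpa using hε)) hℓ0)
    have h2 : growthFactor A ρ ε ^ (2 * (ℓ - 1)) ≠ 0 :=
      pow_ne_zero _ (zero_lt_one.trans_le (le_max_left _ _)).ne'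
    have h3 : max ‖Q‖ₑ ‖R‖ₑ / ENNReal.ofReal (min (sigmaMin R) (sigmaMin Q)) ≠ 0 :=
      ENNReal.div_ne_zero.2 ⟨(lt_of_lt_of_le (by simpa using norm_pos_iff.1 hR0)
        (le_max_right _ _)).ne', ENNReal.ofReal_ne_top⟩
    rw [dareBound, h1, ENNReal.top_mul h2, ENNReal.top_mul (by simp), ENNReal.top_mul (by simp),
      ENNReal.top_mul (by simpa using norm_pos_iff.1 hP0), ENNReal.top_mul h3]
  set T := (transient A ρ).toReal with hTdef
  have hετ : (ε : ℝ≥0∞) * transient A ρ ≠ ∞ := ENNReal.mul_ne_top ENNReal.coe_ne_top hτ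
  have hβ : (growthFactor A ρ ε).toReal = max 1 (ε * T + ρ) := by
    rw [growthFactor, ENNReal.toReal_max ENNReal.one_ne_top
      (ENNReal.add_ne_top.2 ⟨hετ, ENNReal.coe_ne_top⟩),
      ENNReal.toReal_add hετ ENNReal.coe_ne_top]
    simp [hTdef]
  have hT1 : 1 ≤ T := by
    have := ENNReal.toReal_mono hτ (one_le_transient A ρ)
    simpa using this
  have hreal : (dareBound A B Q R P ℓ ν ρ ε).toReal =
      32 * (ε * (ℓ : ℝ) ^ (5 / 2 : ℝ) * T ^ 3 * ((max 1 (ε * T + ρ : ℝ)) ^ (ℓ - 1)) ^ 2 *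
        (1 + 1 / (ν : ℝ)) * (1 + ‖B‖) ^ 2) * ‖P‖ *
          (max ‖Q‖ ‖R‖ / min (sigmaMin R) (sigmaMin Q)) := by
    have h1 : (1 + 1 / (ν : ℝ≥0∞)).toReal = 1 + 1 / (ν : ℝ) := by
      rw [ENNReal.toReal_add ENNReal.one_ne_top (by simpa using hν.ne')]
      simp
    have h2 : (1 + ‖B‖ₑ).toReal = 1 + ‖B‖ := by
      rw [ENNReal.toReal_add ENNReal.one_ne_top (by simp)]
      simp
    have h3 : (max ‖Q‖ₑ ‖R‖ₑ).toReal = max ‖Q‖ ‖R‖ := by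
      rw [ENNReal.toReal_max (by simp) (by simp)]
      simp
    simp only [dareBound, ENNReal.toReal_mul, ENNReal.toReal_pow, ENNReal.toReal_div, hβ, h1, h2,
      h3, ← ENNReal.toReal_rpow, toReal_enorm, ENNReal.toReal_ofReal hs0.le,
      ENNReal.coe_toReal, ENNReal.toReal_natCast, ENNReal.toReal_ofNat]
    rw [mul_comm 2 (ℓ - 1), pow_mul]
    ring
  have hL : ((ℓ : ℝ) ^ (5 / 2 : ℝ)) ^ 2 = (ℓ : ℝ) ^ 5 := by
    rw [← Real.rpow_natCast, ← Real.rpow_mul (Nat.cast_nonneg _), ← Real.rpow_natCast]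
    norm_num
  have hle1 : (dareBound A B Q R P ℓ ν ρ ε).toReal ≤ 1 := by
    simpa using ENNReal.toReal_mono ENNReal.one_ne_top hle
  rw [hreal] at hle1
  obtain ⟨hex', hbound⟩ := exists_riccati_of_perturb hQ hR hR1 hν hctrb
    (NNReal.coe_pos.2 (pos_iff_ne_zero.2 hε)) hT1 ρ.2 (norm_pow_le_transient hτ)
    (le_max_left _ _) (le_max_right _ _) (by positivity) hL hA hB hP rfl hle1
  refine ⟨hex', ?_⟩
  rw [← ofReal_norm, ← ENNReal.ofReal_toReal hne, hreal]
  exact ENNReal.ofReal_le_ofReal (hbound _ (isRiccatiSolution_dare hex'))
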